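/- **Notation.** Functions are complex-valued and measurable on $[0,1]$ with Lebesgue measure. $f^*$ is the non-increasing rearrangement of $|f|$ and $(c_k^*)_{k\ge 1}$ is the non-increasing rearrangement of $(|c_n|)_n$; $1/\infty=0$, and sums are replaced by suprema when an exponent is $\infty$. For $\alpha\in\mathbb R$ and $2\le q\le\infty$, let $L_{2,q}(\log L)_\alpha$ be the space of all $f$ with $$\|f\|_{L_{2,q}(\log L)_\alpha}=\Big\|t^{1/2-1/q}(1+|\log t|)^{\alpha}f^*(t)\Big\|_{L_q(0,1)}<\infty,\qquad L_{2,q}=L_{2,q}(\log L)_0,$$ and let $l^{\mathcal L}_{2,q,\alpha,2}$ be the space of all families $c=(c_n)$ with $$\|c\|_{l^{\mathcal L}_{2,q,\alpha,2}}=\Big(\sum_{k=1}^\infty\Big[k^{-1/q}(1+\log k)^{\alpha}\Big(\sum_{i=1}^k(c_i^*)^2\Big)^{1/2}\Big]^q\Big)^{1/q}<\infty .$$ Let $\{\varphi_n\}_{n\in I}$ ($I\neq\emptyset$ any index set, for instance $\mathbb N$ or $\mathbb Z$) be an orthonormal system in $L_2(0,1)$ with $\sup_n\|\varphi_n\|_{L_\infty}=M<\infty$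 (hence $M\ge1$), and put $\mathcal F(f)=(c_n(f))_{n\in I}$, $c_n(f)=\int_0^1 f(x)\overline{\varphi_n(x)}\,dx$. **Statement.** 1. Let $2\le q\le\infty$ and $\alpha<\tfrac12-\tfrac1q$. There is a constant $C>0$ depending only on $q$ and $\alpha$ such that, for every such system and every $f\in L_{2,q}(\log L)_\alpha$, the functions $f$ and $f\overline{\varphi_n}$ ($n \in I$) are integrable on $[0,1]$ and $$\|\mathcal F(f)\|_{l^{\mathcal L}_{2,q,\alpha-1/2,2}}\le C\,\min\big(M,(1+\log M)^{|\alpha-1/2|}\big)\,\|f\|_{L_{2,q}(\log L)_\alpha}.$$ 2. In particular, for $2<q\le\infty$ there is a constant $C>0$ depending only on $q$ such that, for every such system and every $f\in L_{2,q}$, $$\|\mathcal F(f)\|_{l^{\mathcal L}_{2,q,-1/2,2}}\le C\,(1+\log M)^{1/2}\,\|f\|_{L_{2,q}}.$$ 3. For $2<q\le\infty$ and $\alpha<\tfrac12-\tfrac1q$ there is a constant $C>0$ depending only on $q$ and $\alpha$ such that, for every family $c$ of complex numbers, $$\|c\|_{l^{\mathcal L}_{2,\infty,1/q-1/2+\alpha,2}}\le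 C\,\|c\|_{l^{\mathcal L}_{2,q,\alpha-1/2,2}}.$$ Thus 1 improves the estimate of $\mathcal F:L_{2,q}(\log L)_\alpha\to l^{\mathcal L}_{2,\infty,1/q-1/2+\alpha,2}$ with norm at most a constant times $M$, due to Bochkarev for $\alpha=0$ and to Oba, Sato and Sato in general. -/

import Mathlib

open MeasureTheory Set
open scoped ENNReal

noncomputable section

namespace LorentzFourier

/-- Lebesgue measure on `[0,1]`. -/
abbrev μI : Measure ℝ := volume.restrict (Icc (0 : ℝ) 1)

/-- The non-increasing rearrangement of `|f|` for a function `f` on `[0,1]`: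
`f^*(t) = inf {s ≥ 0 : |{x ∈ [0,1] : |f x| > s}| ≤ t}`. -/
def rearrangement (f : ℝ → ℂ) (t : ℝ) : ℝ≥0∞ :=
  sInf {s : ℝ≥0∞ | μI {x | s < ‖f x‖ₑ} ≤ ENNReal.ofReal t}

/-- The non-increasing rearrangement of `{|c_n|}`, used for `k = 1, 2, …`:
`c_k^* = inf {s ≥ 0 : #{n : |c_n| > s} < k}`. -/
def seqRearrangement {ι : Type*} (c : ι → ℂ) (k : ℕ) : ℝ≥0∞ :=
  sInf {s : ℝ≥0∞ | {n | s < ‖c n‖ₑ}.encard < (k : ℕ∞)}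

/-- The (quasi-)norm of the Lorentz–Zygmund space `L_{p,q}(log L)_α`:
the `L_q(0,1)` norm of `t^{1/p-1/q} (1+|log t|)^α f^*(t)`. Here `1/∞ = 0`. -/
def lorentzZygmundNorm (p q : ℝ≥0∞) (α : ℝ) (f : ℝ → ℂ) : ℝ≥0∞ :=
  eLpNorm (fun t : ℝ =>
      ENNReal.ofReal (t ^ (p⁻¹.toReal - q⁻¹.toReal) * (1 + |Real.log t|) ^ α) *
        rearrangement f t)
    q (volume.restrict (Ioo (0 : ℝ) 1))

/-- `f` belongs to the Lorentz–Zygmund space `L_{p,q}(log L)_α`. -/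
def MemLorentzZygmund (p q : ℝ≥0∞) (α : ℝ) (f : ℝ → ℂ) : Prop :=
  AEStronglyMeasurable f μI ∧ lorentzZygmundNorm p q α f < ∞

/-- The (quasi-)norm of `l^𝓛_{p,q,α,r}`: the `l_q` norm over `k ≥ 1` of
`k^{-1/q} (1+log k)^α ‖(i^{1/p-1/r} c_i^*)_{1 ≤ i ≤ k}‖_{l_r}`.
With respect to counting measure `eLpNorm` is the `l_q` norm (a supremum for `q = ∞`). -/
def seqLNorm {ι : Type*} (p q : ℝ≥0∞) (α : ℝ) (r : ℝ≥0∞) (c : ι → ℂ) : ℝ≥0∞ :=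
  eLpNorm (fun k : ℕ =>
      ENNReal.ofReal ((k : ℝ) ^ (-q⁻¹.toReal) * (1 + Real.log k) ^ α) *
        eLpNorm (fun i : ℕ =>
            ENNReal.ofReal ((i : ℝ) ^ (p⁻¹.toReal - r⁻¹.toReal)) * seqRearrangement c i)
          r (Measure.count.restrict (Icc 1 k)))
    q (Measure.count.restrict (Ici 1))

/-- The Fourier coefficients of `f` with respect to the system `φ`:
`c_n(f) = ∫_0^1 f(x) conj(φ_n(x)) dx`. -/
def coeffs {ι : Type*} (φ : ι → Lp ℂ 2 μI) (f : ℝ → ℂ) (n : ι) : ℂ :=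
  ∫ x, f x * starRingEnd ℂ (φ n x) ∂μI

/-- `φ` is an orthonormal system in `L_2(0,1)` which is bounded in `L_∞(0,1)`, with
`sup_n ‖φ_n‖_{L_∞} = M < ∞`. -/
def IsBoundedOrthonormal {ι : Type*} (φ : ι → Lp ℂ 2 μI) (M : ℝ) : Prop :=
  Orthonormal ℂ φ ∧ (⨆ n, eLpNorm (φ n) ∞ μI) = ENNReal.ofReal M

end LorentzFourier

end

/-!
All norms are discretized along dyadic scales. With `b_j = 2^{-j/2} f^*(2^{-j})`, the norm of `f`
dominates the `ℓ^q` norm of `(1+j)^α b_j`. Split `f` at the level `f^*(2^{-n})`. By Bessel's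
inequality the coefficients of the lower part have `ℓ^2` norm at most a constant times the head
`(∑_{j ≤ n} b_j^2)^{1/2}`. Each coefficient of the peak is at most `M` times its `L_1` norm, which
is controlled by `2^{-n/2}` times the tail `∑_i 2^{-i/2} b_{n+i}`. Hence, for `k = 2^m`, the first
`k` rearranged coefficients have `ℓ^2` norm at most a constant times the head plus
`M (k 2^{-n})^{1/2}` times the tail.
The condition `α < 1/2 - 1/q` is exactly what Hardy's inequality requires to sum the heads, at the
cost of half a power of the logarithm, while the tails are harmless. Taking `n = m` gives the factor
`M`; taking `n = m + a` with `2^{a/2} ≈ M` removes `M` and costs only a shift of the logarithmic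
weight by `a`, that is the factor `(1 + log M)^{|α-1/2|}`.
-/

noncomputable section

namespace LorentzFourier

open scoped NNReal

/-! ### `L^q` norms of `ℝ≥0∞`-valued functions -/

section ELpNorm

variable {X ι : Type*} [MeasurableSpace X] {μ : Measure X} {q : ℝ≥0∞}

lemma eLpNorm_iSup_le {f : ℕ → X → ℝ≥0∞} (hf : ∀ n, Measurable (f n)) (hmono : Monotone f) :
    eLpNorm (fun x => ⨆ n, f n x) q μ ≤ ⨆ n, eLpNorm (f n) q μ := by
  rcases eq_or_ne q 0 with rfl | hq0
  · simp
  rcases eq_or_ne q ∞ with rfl | hqt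
  · have hbound : ∀ᵐ x ∂μ, ∀ n, f n x ≤ eLpNorm (f n) ∞ μ :=
      ae_all_iff.2 fun n => by simpa using enorm_ae_le_eLpNormEssSup (f n) μ
    rw [eLpNorm_exponent_top]
    refine essSup_le_of_ae_le _ (hbound.mono fun x hx => ?_)
    exact iSup_mono hx
  · have hq : 0 < q.toReal := ENNReal.toReal_pos hq0 hqt
    have rpow_iSup : ∀ {r : ℝ} (_ : 0 < r) (g : ℕ → ℝ≥0∞), (⨆ n, g n) ^ r = ⨆ n, g n ^ r :=
      fun hr g => (ENNReal.orderIsoRpow _ hr).map_iSup g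
    simp only [eLpNorm_eq_lintegral_rpow_enorm_toReal hq0 hqt, enorm_eq_self]
    rw [← rpow_iSup (by positivity), ← lintegral_iSup (fun n => (hf n).pow_const _)
      fun _ _ h x => ENNReal.rpow_le_rpow (hmono h x) hq.le]
    simp only [rpow_iSup hq, le_refl]

lemma eLpNorm_tsum_le (hq : 1 ≤ q) {f : ℕ → X → ℝ≥0∞} (hf : ∀ i, Measurable (f i)) :
    eLpNorm (fun x => ∑' i, f i x) q μ ≤ ∑' i, eLpNorm (f i) q μ := by
  have hmeas : ∀ n, Measurable (∑ i ∈ Finset.range n, f i) := fun n => by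
    rw [Finset.sum_fn]
    fun_prop
  have hmono : Monotone fun n => ∑ i ∈ Finset.range n, f i := fun m n h =>
    Finset.sum_le_sum_of_subset (Finset.range_mono h)
  calc eLpNorm (fun x => ∑' i, f i x) q μ
      = eLpNorm (fun x => ⨆ n, (∑ i ∈ Finset.range n, f i) x) q μ := by
        simp only [ENNReal.tsum_eq_iSup_nat, Finset.sum_apply]
    _ ≤ ⨆ n, eLpNorm (∑ i ∈ Finset.range n, f i) q μ := eLpNorm_iSup_le hmeas hmono
    _ ≤ ⨆ n, ∑ i ∈ Finset.range n, eLpNorm (f i) q μ :=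
        iSup_mono fun n => eLpNorm_sum_le (fun i _ => (hf i).aestronglyMeasurable) hq
    _ = ∑' i, eLpNorm (f i) q μ := ENNReal.tsum_eq_iSup_nat.symm

lemma eLpNorm_const_mul_le (c : ℝ≥0∞) (hc : c ≠ ∞) (F : X → ℝ≥0∞) :
    eLpNorm (fun x => c * F x) q μ ≤ c * eLpNorm F q μ := by
  lift c to ℝ≥0 using hc
  exact eLpNorm_le_mul_eLpNorm_of_ae_le_mul' (.of_forall fun _ => le_rfl) q

lemma eLpNorm_rpow (F : X → ℝ≥0∞) {r : ℝ} (hr : 0 < r) :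
    eLpNorm (fun x => F x ^ r) q μ = eLpNorm F (q * ENNReal.ofReal r) μ ^ r := by
  simpa only [enorm_eq_self] using eLpNorm_enorm_rpow (p := q) (μ := μ) F hr

lemma eLpNorm_withDensity {w : X → ℝ≥0∞} (hw : Measurable w) (hw0 : ∀ᵐ x ∂μ, w x ≠ 0)
    (hwt : ∀ᵐ x ∂μ, w x ≠ ∞) (hq : q ≠ 0) (F : X → ℝ≥0∞) :
    eLpNorm F q (μ.withDensity w) = eLpNorm (fun x => w x ^ q⁻¹.toReal * F x) q μ := by
  rcases eq_or_ne q ∞ with rfl | hqt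
  · simp only [ENNReal.inv_top, ENNReal.toReal_zero, ENNReal.rpow_zero, one_mul,
      eLpNorm_exponent_top]
    exact le_antisymm
      (eLpNormEssSup_mono_measure _ (withDensity_absolutelyContinuous μ w))
      (eLpNormEssSup_mono_measure _ (withDensity_absolutelyContinuous' hw.aemeasurable hw0))
  · have hq' : 0 < q.toReal := ENNReal.toReal_pos hq hqt
    simp only [eLpNorm_eq_lintegral_rpow_enorm_toReal hq hqt, enorm_eq_self]
    rw [lintegral_withDensity_eq_lintegral_mul_non_measurable _ hw
      (hwt.mono fun x hx => lt_top_iff_ne_top.2 hx)]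
    congr 2 with x
    rw [Pi.mul_apply, ENNReal.mul_rpow_of_nonneg _ _ hq'.le, ← ENNReal.rpow_mul,
      ENNReal.toReal_inv, inv_mul_cancel₀ hq'.ne', ENNReal.rpow_one]

lemma eLpNorm_count_eq_tsum [MeasurableSpace ι] [MeasurableSingletonClass ι] (hq0 : q ≠ 0)
    (hqt : q ≠ ∞) (F : ι → ℝ≥0∞) :
    eLpNorm F q Measure.count = (∑' i, F i ^ q.toReal) ^ (1 / q.toReal) := by
  simp only [eLpNorm_eq_lintegral_rpow_enorm_toReal hq0 hqt, enorm_eq_self, lintegral_count]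

lemma eLpNorm_count_comp_le {e : ℕ → ℕ} (he : Function.Injective e) (F : ℕ → ℝ≥0∞) :
    eLpNorm (F ∘ e) q Measure.count ≤ eLpNorm F q Measure.count := by
  rw [← eLpNorm_map_measure (by fun_prop) (by fun_prop)]
  exact eLpNorm_mono_measure _ (he.map_count_le (by fun_prop))

end ELpNorm

/-! ### Hardy's inequality with logarithmic weights -/

lemma rpow_le_rpow_abs_mul_rpow {x y L : ℝ≥0∞} (hL0 : L ≠ 0) (hLt : L ≠ ∞) (hxy : x ≤ L * y)
    (hyx : y ≤ L * x) (α : ℝ) : x ^ α ≤ L ^ |α| * y ^ α := by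
  rcases le_total 0 α with hα | hα
  · rw [abs_of_nonneg hα, ← ENNReal.mul_rpow_of_nonneg _ _ hα]
    exact ENNReal.rpow_le_rpow hxy hα
  · obtain ⟨β, hβ, rfl⟩ : ∃ β : ℝ, 0 ≤ β ∧ α = -β := ⟨-α, neg_nonneg.2 hα, (neg_neg α).symm⟩
    rw [abs_neg, abs_of_nonneg hβ, ENNReal.rpow_neg, ENNReal.rpow_neg, ← div_eq_mul_inv,
      ENNReal.le_div_iff_mul_le (.inr (by simp [ENNReal.rpow_eq_zero_iff, hL0, hLt]))
        (.inr (by simp [ENNReal.rpow_eq_top_iff, hL0, hLt])), mul_comm, ← div_eq_mul_inv]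
    refine ENNReal.div_le_of_le_mul ?_
    rw [← ENNReal.mul_rpow_of_nonneg _ _ hβ]
    exact ENNReal.rpow_le_rpow hyx hβ

/-- The logarithmic weight `(1 + |log t|)^α` at the dyadic points `t = 2^{±n}`, up to constants. -/
def levelWeight (α : ℝ) (n : ℕ) : ℝ≥0∞ := (1 + n) ^ α

lemma one_add_natCast_ne_top (n : ℕ) : (1 + n : ℝ≥0∞) ≠ ∞ := by finiteness

lemma levelWeight_ne_zero (α : ℝ) (n : ℕ) : levelWeight α n ≠ 0 :=
  (ENNReal.rpow_pos (by positivity) (one_add_natCast_ne_top n)).ne'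

lemma levelWeight_ne_top (α : ℝ) (n : ℕ) : levelWeight α n ≠ ∞ :=
  ENNReal.rpow_ne_top_of_ne_zero (by simp) (one_add_natCast_ne_top n)

lemma levelWeight_eq_ofReal (α : ℝ) (n : ℕ) :
    levelWeight α n = ENNReal.ofReal ((1 + n : ℝ) ^ α) := by
  rw [levelWeight, ← ENNReal.ofReal_rpow_of_pos (by positivity),
    ENNReal.ofReal_add zero_le_one n.cast_nonneg, ENNReal.ofReal_one, ENNReal.ofReal_natCast]

lemma levelWeight_zero (n : ℕ) : levelWeight 0 n = 1 := ENNReal.rpow_zero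

lemma levelWeight_mul (α β : ℝ) (n : ℕ) :
    levelWeight α n * levelWeight β n = levelWeight (α + β) n :=
  (ENNReal.rpow_add _ _ (by simp) (one_add_natCast_ne_top n)).symm

lemma levelWeight_rpow (α s : ℝ) (n : ℕ) : levelWeight α n ^ s = levelWeight (α * s) n :=
  (ENNReal.rpow_mul _ _ _).symm

lemma levelWeight_le_mul_add (α : ℝ) (n i : ℕ) :
    levelWeight α n ≤ levelWeight |α| i * levelWeight α (n + i) := by
  refine rpow_le_rpow_abs_mul_rpow (by simp) (one_add_natCast_ne_top i) ?_ ?_ α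
  · exact_mod_cast (by nlinarith : 1 + n ≤ (1 + i) * (1 + (n + i)))
  · exact_mod_cast (by nlinarith : 1 + (n + i) ≤ (1 + i) * (1 + n))

/-- The norm of the weighted sequence space `ℓ^q((1+n)^α)`. -/
def levelNorm (q : ℝ≥0∞) (α : ℝ) (b : ℕ → ℝ≥0∞) : ℝ≥0∞ :=
  eLpNorm (fun n => levelWeight α n * b n) q Measure.count

section PowerSums

variable {u : ℝ}

lemma min_one_mul_rpow_sub_one_le (hu : 0 < u) {x : ℝ} (hx : 0 ≤ x) :
    min u 1 * (x + 1) ^ (u - 1) ≤ (x + 1) ^ u - x ^ u := by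
  have hx1 : 0 < x + 1 := by positivity
  have bernoulli : (x / (x + 1)) ^ u ≤ 1 - min u 1 * (x + 1)⁻¹ := by
    have hz : x / (x + 1) = 1 + -(x + 1)⁻¹ := by field_simp; ring
    rcases le_total 1 u with h | h
    · rw [min_eq_right h, one_mul, sub_eq_add_neg, ← hz]
      exact Real.rpow_le_self_of_le_one (by positivity)
        (div_le_one_of_le₀ (by linarith) hx1.le) h
    · rw [min_eq_left h, hz]
      have := rpow_one_add_le_one_add_mul_self (s := -(x + 1)⁻¹)
        (by have := inv_le_one_of_one_le₀ (le_add_of_nonneg_left hx); linarith) hu.le h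
      linarith
  rw [Real.div_rpow hx hx1.le, div_le_iff₀ (by positivity)] at bernoulli
  rw [Real.rpow_sub_one hx1.ne']
  calc min u 1 * ((x + 1) ^ u / (x + 1))
      = (x + 1) ^ u - (1 - min u 1 * (x + 1)⁻¹) * (x + 1) ^ u := by ring
    _ ≤ (x + 1) ^ u - x ^ u := by gcongr

lemma min_one_mul_rpow_neg_sub_one_le (hu : 0 < u) {x : ℝ} (hx : 1 ≤ x) :
    min u 1 / 2 * x ^ (-u - 1) ≤ x ^ (-u) - (x + 1) ^ (-u) := by
  have hx0 : 0 < x := by positivity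
  have h := min_one_mul_rpow_sub_one_le hu hx0.le
  rw [Real.rpow_sub_one (by positivity)] at h
  rw [Real.rpow_sub_one hx0.ne', Real.rpow_neg hx0.le, Real.rpow_neg (by positivity)]
  calc min u 1 / 2 * ((x ^ u)⁻¹ / x) = min u 1 * (x ^ u)⁻¹ * (2 * x)⁻¹ := by field_simp
    _ ≤ min u 1 * (x ^ u)⁻¹ * (x + 1)⁻¹ := by gcongr; linarith
    _ = min u 1 * ((x + 1) ^ u / (x + 1)) * ((x ^ u)⁻¹ * ((x + 1) ^ u)⁻¹) := by field_simp
    _ ≤ ((x + 1) ^ u - x ^ u) * ((x ^ u)⁻¹ * ((x + 1) ^ u)⁻¹) := by gcongr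
    _ = (x ^ u)⁻¹ - ((x + 1) ^ u)⁻¹ := by field_simp

lemma exists_sum_range_levelWeight_le (hu : 0 < u) : ∃ A : ℝ≥0, ∀ n,
    ∑ j ∈ Finset.range (n + 1), levelWeight (u - 1) j ≤ A * levelWeight u n := by
  have hc : 0 < min u 1 := lt_min hu one_pos
  refine ⟨(min u 1)⁻¹.toNNReal, fun n => ?_⟩
  simp only [levelWeight_eq_ofReal]
  rw [← ENNReal.ofReal_sum_of_nonneg (fun _ _ => by positivity), ← ENNReal.ofReal,
    ← ENNReal.ofReal_mul (by positivity)]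
  refine ENNReal.ofReal_le_ofReal ((le_inv_mul_iff₀ hc).2 ?_)
  calc min u 1 * ∑ j ∈ Finset.range (n + 1), (1 + j : ℝ) ^ (u - 1)
      ≤ ∑ j ∈ Finset.range (n + 1), (((j + 1 : ℕ) : ℝ) ^ u - (j : ℝ) ^ u) := by
        rw [Finset.mul_sum]
        refine Finset.sum_le_sum fun j _ => ?_
        rw [add_comm, Nat.cast_add_one]
        exact min_one_mul_rpow_sub_one_le hu j.cast_nonneg
    _ = (1 + n : ℝ) ^ u := by
        rw [Finset.sum_range_sub fun j : ℕ => (j : ℝ) ^ u, Nat.cast_zero, Real.zero_rpow hu.ne',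
          sub_zero, Nat.cast_add_one, add_comm]

lemma exists_tsum_levelWeight_add_le (hu : 0 < u) : ∃ B : ℝ≥0, ∀ j,
    ∑' i, levelWeight (-u - 1) (j + i) ≤ B * levelWeight (-u) j := by
  have hc : 0 < min u 1 / 2 := half_pos (lt_min hu one_pos)
  refine ⟨(min u 1 / 2)⁻¹.toNNReal, fun j => ?_⟩
  rw [ENNReal.tsum_eq_iSup_nat]
  refine iSup_le fun n => ?_
  simp only [levelWeight_eq_ofReal]
  rw [← ENNReal.ofReal_sum_of_nonneg (fun _ _ => by positivity), ← ENNReal.ofReal,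
    ← ENNReal.ofReal_mul (by positivity)]
  refine ENNReal.ofReal_le_ofReal ((le_inv_mul_iff₀ hc).2 ?_)
  calc min u 1 / 2 * ∑ i ∈ Finset.range n, (1 + (j + i : ℕ) : ℝ) ^ (-u - 1)
      ≤ ∑ i ∈ Finset.range n,
          ((1 + (j + i : ℕ) : ℝ) ^ (-u) - (1 + (j + (i + 1) : ℕ) : ℝ) ^ (-u)) := by
        rw [Finset.mul_sum]
        refine Finset.sum_le_sum fun i _ => ?_
        rw [← add_assoc j i 1, Nat.cast_add_one, ← add_assoc]
        exact min_one_mul_rpow_neg_sub_one_le hu (le_add_of_nonneg_right (Nat.cast_nonneg _))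
    _ = (1 + j : ℝ) ^ (-u) - (1 + (j + n : ℕ) : ℝ) ^ (-u) := by
        rw [Finset.sum_range_sub' fun i : ℕ => (1 + (j + i : ℕ) : ℝ) ^ (-u), add_zero]
    _ ≤ (1 + j : ℝ) ^ (-u) := sub_le_self _ (by positivity)

end PowerSums

section Schur

variable {ι κ : Type*}

lemma rpow_tsum_mul_le {s : ℝ} (hs : 1 ≤ s) (w f : ι → ℝ≥0∞) :
    (∑' j, w j * f j) ^ s ≤ (∑' j, w j) ^ (s - 1) * ∑' j, w j * f j ^ s := by
  have hs0 : 0 < s := by linarith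
  have hs' : 0 ≤ 1 - s⁻¹ := sub_nonneg.2 (inv_le_one_of_one_le₀ hs)
  have holder : ∑' j, w j * f j ≤ (∑' j, w j) ^ (1 - s⁻¹) * (∑' j, w j * f j ^ s) ^ s⁻¹ := by
    rw [ENNReal.tsum_eq_iSup_sum]
    refine iSup_le fun F => (ENNReal.inner_le_weight_mul_Lp_of_nonneg F hs w f).trans ?_
    gcongr <;> exact ENNReal.sum_le_tsum F
  calc (∑' j, w j * f j) ^ s
      ≤ ((∑' j, w j) ^ (1 - s⁻¹) * (∑' j, w j * f j ^ s) ^ s⁻¹) ^ s := by gcongr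
    _ = (∑' j, w j) ^ (s - 1) * ∑' j, w j * f j ^ s := by
      rw [ENNReal.mul_rpow_of_nonneg _ _ hs0.le, ← ENNReal.rpow_mul, ← ENNReal.rpow_mul,
        inv_mul_cancel₀ hs0.ne', ENNReal.rpow_one, sub_mul, one_mul, inv_mul_cancel₀ hs0.ne']

variable {K : ι → κ → ℝ≥0∞} {A : ℝ≥0}

lemma tsum_rpow_tsum_mul_le_of_schur {s : ℝ} (hs : 1 ≤ s) {g : ι → ℝ≥0∞} {h : κ → ℝ≥0∞}
    (h0 : ∀ j, h j ≠ 0) (ht : ∀ j, h j ≠ ∞) {B : ℝ≥0}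
    (hA : ∀ n, ∑' j, K n j * h j ≤ A * g n)
    (hB : ∀ j, ∑' n, K n j * g n ^ (s - 1) ≤ B * h j ^ (s - 1)) (x : κ → ℝ≥0∞) :
    ∑' n, (∑' j, K n j * x j) ^ s ≤ A ^ (s - 1) * B * ∑' j, x j ^ s := by
  have hs1 : 0 ≤ s - 1 := by linarith
  have hcancel : ∀ j, h j * (x j / h j) = x j := fun j => ENNReal.mul_div_cancel (h0 j) (ht j)
  have hsplit : ∀ j, h j * (x j / h j) ^ s * h j ^ (s - 1) = x j ^ s := fun j => by
    conv_rhs => rw [← hcancel j, ENNReal.mul_rpow_of_nonneg _ _ (by linarith),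
      ← add_sub_cancel 1 s, ENNReal.rpow_add _ _ (h0 j) (ht j), ENNReal.rpow_one,
      add_sub_cancel 1 s]
    ring
  calc ∑' n, (∑' j, K n j * x j) ^ s
      = ∑' n, (∑' j, K n j * h j * (x j / h j)) ^ s := by simp only [mul_assoc, hcancel]
    _ ≤ ∑' n, (A * g n) ^ (s - 1) * ∑' j, K n j * h j * (x j / h j) ^ s := by
        refine ENNReal.tsum_le_tsum fun n => (rpow_tsum_mul_le hs _ _).trans ?_
        gcongr
        exact hA n
    _ = A ^ (s - 1) * ∑' j, h j * (x j / h j) ^ s * ∑' n, K n j * g n ^ (s - 1) := by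
        simp only [← ENNReal.tsum_mul_left, ENNReal.mul_rpow_of_nonneg _ _ hs1]
        rw [ENNReal.tsum_comm]
        exact tsum_congr fun j => tsum_congr fun n => by ring
    _ ≤ A ^ (s - 1) * ∑' j, h j * (x j / h j) ^ s * (B * h j ^ (s - 1)) := by
        gcongr with j
        exact hB j
    _ = A ^ (s - 1) * B * ∑' j, x j ^ s := by
        rw [mul_assoc, ← ENNReal.tsum_mul_left (a := (B : ℝ≥0∞))]
        simp only [mul_left_comm _ (B : ℝ≥0∞), hsplit]

variable [MeasurableSpace ι] [MeasurableSingletonClass ι] [MeasurableSpace κ]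
  [MeasurableSingletonClass κ]

lemma exists_eLpNorm_le_of_schur {s : ℝ≥0∞} (hs : 1 ≤ s) (hst : s ≠ ∞) {g : ι → ℝ≥0∞}
    {h : κ → ℝ≥0∞} (h0 : ∀ j, h j ≠ 0) (ht : ∀ j, h j ≠ ∞) {B : ℝ≥0}
    (hA : ∀ n, ∑' j, K n j * h j ≤ A * g n)
    (hB : ∀ j, ∑' n, K n j * g n ^ (s.toReal - 1) ≤ B * h j ^ (s.toReal - 1)) :
    ∃ C : ℝ≥0, ∀ x : κ → ℝ≥0∞,
      eLpNorm (fun n => ∑' j, K n j * x j) s Measure.count ≤ C * eLpNorm x s Measure.count := by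
  have hs0 : s ≠ 0 := (zero_lt_one.trans_le hs).ne'
  have hs1 : 1 ≤ s.toReal := ENNReal.toReal_one ▸ ENNReal.toReal_mono hst hs
  refine ⟨(A ^ (s.toReal - 1) * B) ^ (1 / s.toReal), fun x => ?_⟩
  rw [eLpNorm_count_eq_tsum hs0 hst, eLpNorm_count_eq_tsum hs0 hst,
    ENNReal.coe_rpow_of_nonneg _ (by positivity), ← ENNReal.mul_rpow_of_nonneg _ _ (by positivity),
    ENNReal.coe_mul, ENNReal.coe_rpow_of_nonneg _ (by linarith)]
  gcongr
  exact tsum_rpow_tsum_mul_le_of_schur hs1 h0 ht hA hB x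

lemma eLpNorm_top_le_of_tsum_le (hA : ∀ n, ∑' j, K n j ≤ A) (x : κ → ℝ≥0∞) :
    eLpNorm (fun n => ∑' j, K n j * x j) ∞ Measure.count ≤ A * eLpNorm x ∞ Measure.count := by
  simp only [eLpNorm_exponent_top, eLpNormEssSup_count, enorm_eq_self]
  refine iSup_le fun n => ?_
  calc ∑' j, K n j * x j ≤ ∑' j, K n j * ⨆ i, x i := by
        gcongr with j
        exact le_iSup x j
    _ = (∑' j, K n j) * ⨆ i, x i := ENNReal.tsum_mul_right
    _ ≤ A * ⨆ i, x i := by gcongr; exact hA n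

end Schur

/-- The kernel `(1+n)^{a-1} (1+j)^{-a}`, `j ≤ n`, of the averaging operator of Hardy. -/
def hardyKernel (a : ℝ) (n j : ℕ) : ℝ≥0∞ :=
  if j ≤ n then levelWeight (a - 1) n * levelWeight (-a) j else 0

lemma tsum_hardyKernel_mul (a : ℝ) (n : ℕ) (x : ℕ → ℝ≥0∞) :
    ∑' j, hardyKernel a n j * x j =
      levelWeight (a - 1) n * ∑ j ∈ Finset.range (n + 1), levelWeight (-a) j * x j := by
  rw [tsum_eq_sum (s := Finset.range (n + 1)) fun j hj => by
      rw [hardyKernel, if_neg (by simpa [Nat.lt_succ_iff] using hj), zero_mul], Finset.mul_sum]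
  refine Finset.sum_congr rfl fun j hj => ?_
  rw [hardyKernel, if_pos (Nat.lt_succ_iff.1 (Finset.mem_range.1 hj)), mul_assoc]

lemma tsum_hardyKernel_mul_left (a : ℝ) (j : ℕ) (y : ℕ → ℝ≥0∞) :
    ∑' n, hardyKernel a n j * y n =
      levelWeight (-a) j * ∑' i, levelWeight (a - 1) (j + i) * y (j + i) := by
  rw [← Summable.sum_add_tsum_nat_add' (k := j) ENNReal.summable, Finset.sum_eq_zero fun n hn => by
      rw [hardyKernel, if_neg (not_le.2 (Finset.mem_range.1 hn)), zero_mul], zero_add,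
    ← ENNReal.tsum_mul_left]
  refine tsum_congr fun i => ?_
  rw [add_comm i j, hardyKernel, if_pos (Nat.le_add_right j i)]
  ring

/-- The test sequence `(1+j)^{-1/s}` serves rows and columns alike: in both cases the sums to be
estimated are governed by the single positive number `1 - 1/s - a`. -/
lemma exists_eLpNorm_hardyKernel_le {s : ℝ≥0∞} {a : ℝ} (hs : 1 ≤ s) (ha : a < 1 - s⁻¹.toReal) :
    ∃ C : ℝ≥0, ∀ x : ℕ → ℝ≥0∞,
      eLpNorm (fun n => ∑' j, hardyKernel a n j * x j) s Measure.count ≤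
        C * eLpNorm x s Measure.count := by
  have hu : 0 < 1 - s⁻¹.toReal - a := by linarith
  obtain ⟨A, hA⟩ := exists_sum_range_levelWeight_le hu
  obtain ⟨B, hB⟩ := exists_tsum_levelWeight_add_le hu
  have row : ∀ n, ∑' j, hardyKernel a n j * levelWeight (-s⁻¹.toReal) j ≤
      A * levelWeight (-s⁻¹.toReal) n := fun n => by
    have hJ : -a + -s⁻¹.toReal = 1 - s⁻¹.toReal - a - 1 := by ring
    have hN : a - 1 + (1 - s⁻¹.toReal - a) = -s⁻¹.toReal := by ring
    simp only [tsum_hardyKernel_mul, levelWeight_mul, hJ]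
    calc _ ≤ levelWeight (a - 1) n * (A * levelWeight (1 - s⁻¹.toReal - a) n) := by
          gcongr
          exact hA n
      _ = A * levelWeight (-s⁻¹.toReal) n := by rw [mul_left_comm, levelWeight_mul, hN]
  rcases eq_or_ne s ∞ with rfl | hst
  · exact ⟨A, eLpNorm_top_le_of_tsum_le fun n => by simpa [levelWeight_zero] using row n⟩
  have col : ∀ j, ∑' n, hardyKernel a n j * levelWeight (-s⁻¹.toReal) n ^ (s.toReal - 1) ≤
      B * levelWeight (-s⁻¹.toReal) j ^ (s.toReal - 1) := fun j => by
    have hs0 : s.toReal ≠ 0 := (ENNReal.toReal_pos (zero_lt_one.trans_le hs).ne' hst).ne'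
    have hexp : -s⁻¹.toReal * (s.toReal - 1) = -1 + s⁻¹.toReal := by
      rw [ENNReal.toReal_inv, mul_sub, neg_mul, inv_mul_cancel₀ hs0]
      ring
    have hN : a - 1 + (-1 + s⁻¹.toReal) = -(1 - s⁻¹.toReal - a) - 1 := by ring
    have hJ : -a + -(1 - s⁻¹.toReal - a) = -1 + s⁻¹.toReal := by ring
    simp only [tsum_hardyKernel_mul_left, levelWeight_rpow, hexp, levelWeight_mul, hN]
    calc _ ≤ levelWeight (-a) j * (B * levelWeight (-(1 - s⁻¹.toReal - a)) j) := by
          gcongr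
          exact hB j
      _ = B * levelWeight (-1 + s⁻¹.toReal) j := by rw [mul_left_comm, levelWeight_mul, hJ]
  exact exists_eLpNorm_le_of_schur hs hst (levelWeight_ne_zero _) (levelWeight_ne_top _) row col

/-- If `b j` is the `L_2` norm of a function on a shell of measure about `2^{-j}`, then this is
the `L_2` norm on the complement of a set of measure `2^{-n}`. -/
def dyadicHead (b : ℕ → ℝ≥0∞) (n : ℕ) : ℝ≥0∞ :=
  (∑ j ∈ Finset.range (n + 1), b j ^ (2 : ℝ)) ^ (1 / 2 : ℝ)

/-- If `b j` is the `L_2` norm of a function on a shell of measure about `2^{-j}`, then this is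
`2^{n/2}` times the `L_1` norm on a set of measure `2^{-n}`. -/
def dyadicTail (b : ℕ → ℝ≥0∞) (n : ℕ) : ℝ≥0∞ :=
  ∑' i : ℕ, 2⁻¹ ^ (i / 2 : ℝ) * b (n + i)

lemma exists_levelNorm_dyadicHead_le {q : ℝ≥0∞} {α : ℝ} (hq : 2 ≤ q)
    (hα : α < 1 / 2 - q⁻¹.toReal) : ∃ C : ℝ≥0, ∀ b,
      levelNorm q (α - 1 / 2) (dyadicHead b) ≤ C * levelNorm q α b := by
  obtain ⟨s, rfl⟩ : ∃ s, q = s * 2 := ⟨q / 2, (ENNReal.div_mul_cancel (by simp) (by simp)).symm⟩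
  have hs : 1 ≤ s :=
    (ENNReal.mul_le_mul_iff_left two_ne_zero ENNReal.ofNat_ne_top).1 (by rwa [one_mul])
  have hs2 : (s * 2)⁻¹.toReal = s⁻¹.toReal / 2 := by
    rw [ENNReal.mul_inv (by simp) (by simp), ENNReal.toReal_mul, ENNReal.toReal_inv 2,
      ENNReal.toReal_ofNat, div_eq_mul_inv]
  obtain ⟨C, hC⟩ := exists_eLpNorm_hardyKernel_le (a := 2 * α) hs (by linarith)
  refine ⟨C ^ (1 / 2 : ℝ), fun b => ?_⟩
  have key : ∀ n, levelWeight (α - 1 / 2) n * dyadicHead b n =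
      (∑' j, hardyKernel (2 * α) n j * (levelWeight α j * b j) ^ (2 : ℝ)) ^ (1 / 2 : ℝ) := by
    intro n
    have hJ : ∀ j, levelWeight (-(2 * α)) j * (levelWeight α j * b j) ^ (2 : ℝ) =
        b j ^ (2 : ℝ) := fun j => by
      rw [ENNReal.mul_rpow_of_nonneg _ _ zero_le_two, levelWeight_rpow, ← mul_assoc,
        levelWeight_mul, mul_comm α, neg_add_cancel, levelWeight_zero, one_mul]
    rw [tsum_hardyKernel_mul, ENNReal.mul_rpow_of_nonneg _ _ (by norm_num), levelWeight_rpow,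
      dyadicHead, Finset.sum_congr rfl fun j _ => hJ j]
    congr 2
    ring
  have hs_half : s * 2 * ENNReal.ofReal (1 / 2) = s := by
    rw [mul_assoc, ENNReal.ofReal_div_of_pos two_pos, ENNReal.ofReal_one, ENNReal.ofReal_ofNat,
      ENNReal.mul_div_cancel two_ne_zero ENNReal.ofNat_ne_top, mul_one]
  rw [levelNorm, funext key, eLpNorm_rpow _ (by norm_num), hs_half]
  refine (ENNReal.rpow_le_rpow (hC _) (by norm_num)).trans_eq ?_
  rw [eLpNorm_rpow _ two_pos, ENNReal.ofReal_ofNat, ENNReal.mul_rpow_of_nonneg _ _ (by norm_num),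
    ENNReal.coe_rpow_of_nonneg _ (by norm_num), ← ENNReal.rpow_mul,
    mul_one_div_cancel two_ne_zero, ENNReal.rpow_one, levelNorm]

lemma tsum_levelWeight_mul_rpow_ne_top (α : ℝ) :
    ∑' i : ℕ, levelWeight α i * 2⁻¹ ^ (i / 2 : ℝ) ≠ ∞ := by
  set r : ℝ := (2⁻¹ : ℝ) ^ (2⁻¹ : ℝ)
  have hr0 : 0 < r := by positivity
  have hr1 : r < 1 := Real.rpow_lt_one (by norm_num) (by norm_num) (by norm_num)
  set k := ⌈α⌉₊
  have hsum : Summable fun i : ℕ => ((i + 1 : ℕ) : ℝ) ^ k * r ^ (i + 1) :=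
    (summable_nat_add_iff (f := fun n : ℕ => (n : ℝ) ^ k * r ^ n) 1).2
      (summable_pow_mul_geometric_of_norm_lt_one k (by rwa [Real.norm_of_nonneg hr0.le]))
  refine ne_top_of_le_ne_top (hsum.mul_left r⁻¹).tsum_ofReal_ne_top
    (ENNReal.tsum_le_tsum fun i => ?_)
  have hgeom : (2⁻¹ : ℝ≥0∞) ^ (i / 2 : ℝ) = ENNReal.ofReal (r ^ i) := by
    rw [← ENNReal.ofReal_ofNat, ← ENNReal.ofReal_inv_of_pos two_pos,
      ENNReal.ofReal_rpow_of_pos (by norm_num), ← Real.rpow_mul_natCast (by norm_num)]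
    congr 2
    ring
  rw [hgeom, levelWeight_eq_ofReal, ← ENNReal.ofReal_mul (by positivity)]
  refine ENNReal.ofReal_le_ofReal ?_
  calc (1 + i : ℝ) ^ α * r ^ i ≤ ((i + 1 : ℕ) : ℝ) ^ k * r ^ i := by
        gcongr
        rw [← Real.rpow_natCast, Nat.cast_add_one, add_comm]
        exact Real.rpow_le_rpow_of_exponent_le (by simp) (Nat.le_ceil α)
    _ = r⁻¹ * (((i + 1 : ℕ) : ℝ) ^ k * r ^ (i + 1)) := by
        rw [pow_succ r]
        field_simp

lemma levelNorm_dyadicTail_le {q : ℝ≥0∞} (hq : 1 ≤ q) (α : ℝ) (b : ℕ → ℝ≥0∞) :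
    levelNorm q α (dyadicTail b) ≤
      (∑' i : ℕ, levelWeight |α| i * 2⁻¹ ^ (i / 2 : ℝ)) * levelNorm q α b := by
  have hpoint : ∀ n, levelWeight α n * dyadicTail b n ≤ ∑' i : ℕ,
      levelWeight |α| i * 2⁻¹ ^ (i / 2 : ℝ) * (levelWeight α (n + i) * b (n + i)) := fun n => by
    rw [dyadicTail, ← ENNReal.tsum_mul_left]
    refine ENNReal.tsum_le_tsum fun i => ?_
    calc levelWeight α n * (2⁻¹ ^ (i / 2 : ℝ) * b (n + i))
        ≤ levelWeight |α| i * levelWeight α (n + i) * (2⁻¹ ^ (i / 2 : ℝ) * b (n + i)) := by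
          gcongr
          exact levelWeight_le_mul_add α n i
      _ = _ := by ring
  calc levelNorm q α (dyadicTail b)
      ≤ ∑' i : ℕ, eLpNorm (fun n => levelWeight |α| i * 2⁻¹ ^ (i / 2 : ℝ) *
          (levelWeight α (n + i) * b (n + i))) q Measure.count :=
        (eLpNorm_mono_enorm hpoint).trans (eLpNorm_tsum_le hq fun i => by fun_prop)
    _ ≤ ∑' i : ℕ, levelWeight |α| i * 2⁻¹ ^ (i / 2 : ℝ) * levelNorm q α b := by
        refine ENNReal.tsum_le_tsum fun i => (eLpNorm_const_mul_le _ ?_ _).trans ?_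
        · exact ENNReal.mul_ne_top (levelWeight_ne_top _ _)
            (ENNReal.rpow_ne_top_of_nonneg (by positivity) (by simp))
        · gcongr
          exact eLpNorm_count_comp_le (add_left_injective i) fun n => levelWeight α n * b n
    _ = _ := ENNReal.tsum_mul_right

lemma exists_levelNorm_dyadicTail_le {q : ℝ≥0∞} (hq : 1 ≤ q) (α : ℝ) : ∃ C : ℝ≥0, ∀ b,
    levelNorm q α (dyadicTail b) ≤ C * levelNorm q α b :=
  ⟨(∑' i : ℕ, levelWeight |α| i * 2⁻¹ ^ (i / 2 : ℝ)).toNNReal, fun b => by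
    rw [ENNReal.coe_toNNReal (tsum_levelWeight_mul_rpow_ne_top _)]
    exact levelNorm_dyadicTail_le hq α b⟩

/-! ### Dyadic discretization -/

lemma measure_le_of_singleton_le {X : Type*} [MeasurableSpace X] [MeasurableSingletonClass X]
    [Countable X] {μ ν : Measure X} (h : ∀ x, μ {x} ≤ ν {x}) : μ ≤ ν := by
  refine Measure.le_iff.2 fun s hs => ?_
  rw [← Measure.tsum_indicator_apply_singleton μ s hs,
    ← Measure.tsum_indicator_apply_singleton ν s hs]
  exact ENNReal.tsum_le_tsum fun x => indicator_le_indicator (h x)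

/-- The measure `dk/k` on the positive integers, which absorbs the factor `k^{-1/q}` of the norm
of `l^𝓛_{p,q,α,r}`. -/
def natLogMeasure : Measure ℕ :=
  (Measure.count.restrict (Ici 1)).withDensity fun k => (k : ℝ≥0∞)⁻¹

lemma natLogMeasure_ae_pos : ∀ᵐ k ∂natLogMeasure, 1 ≤ k :=
  (withDensity_absolutelyContinuous _ _).ae_le (ae_restrict_mem (by measurability))

lemma natLogMeasure_Ico {a b : ℕ} (ha : 1 ≤ a) :
    natLogMeasure (Ico a b) = ∑ k ∈ Finset.Ico a b, (k : ℝ≥0∞)⁻¹ := by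
  have hsub : Ico a b ∩ Ici 1 = Ico a b := inter_eq_left.2 fun k hk => ha.trans hk.1
  rw [natLogMeasure, withDensity_apply _ measurableSet_Ico, Measure.restrict_restrict
    measurableSet_Ico, hsub, ← Finset.coe_Ico, lintegral_finset]
  simp only [Measure.count_singleton, mul_one]

lemma map_log_natLogMeasure_le : natLogMeasure.map (Nat.log 2) ≤ Measure.count := by
  refine measure_le_of_singleton_le fun m => ?_
  have hsub : Nat.log 2 ⁻¹' {m} ≤ᵐ[natLogMeasure] Ico (2 ^ m) (2 ^ (m + 1)) := by
    filter_upwards [natLogMeasure_ae_pos] with k hk hkm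
    obtain rfl : Nat.log 2 k = m := hkm
    exact ⟨Nat.pow_log_le_self 2 (by omega), Nat.lt_pow_succ_log_self one_lt_two k⟩
  rw [Measure.map_apply (by fun_prop) (by measurability), Measure.count_singleton]
  calc natLogMeasure (Nat.log 2 ⁻¹' {m})
      ≤ ∑ k ∈ Finset.Ico ((2 : ℕ) ^ m) (2 ^ (m + 1)), (k : ℝ≥0∞)⁻¹ :=
        (measure_mono_ae hsub).trans_eq (natLogMeasure_Ico Nat.one_le_two_pow)
    _ ≤ ∑ _k ∈ Finset.Ico ((2 : ℕ) ^ m) (2 ^ (m + 1)), ((2 : ℝ≥0∞) ^ m)⁻¹ := by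
        gcongr with k hk
        exact_mod_cast (Finset.mem_Ico.1 hk).1
    _ = 1 := by
        rw [Finset.sum_const, Nat.card_Ico, pow_succ, mul_two, Nat.add_sub_cancel, nsmul_eq_mul,
          Nat.cast_pow, Nat.cast_ofNat, ENNReal.mul_inv_cancel (by simp) (by finiteness)]

/-- The `ℓ^r` norm of the first `k` terms of `i^{1/p-1/r} c_i^*`. -/
def truncNorm {ι : Type*} (p r : ℝ≥0∞) (c : ι → ℂ) (k : ℕ) : ℝ≥0∞ :=
  eLpNorm (fun i : ℕ =>
      ENNReal.ofReal ((i : ℝ) ^ (p⁻¹.toReal - r⁻¹.toReal)) * seqRearrangement c i)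
    r (Measure.count.restrict (Icc 1 k))

lemma truncNorm_mono {ι : Type*} (p r : ℝ≥0∞) (c : ι → ℂ) : Monotone (truncNorm p r c) :=
  fun _ _ h => eLpNorm_mono_measure _ (Measure.restrict_mono (Icc_subset_Icc_right h) le_rfl)

lemma seqLNorm_eq_eLpNorm_natLogMeasure {ι : Type*} {p q r : ℝ≥0∞} (hq : q ≠ 0) (β : ℝ)
    (c : ι → ℂ) : seqLNorm p q β r c = eLpNorm (fun k : ℕ =>
      ENNReal.ofReal (1 + Real.log k) ^ β * truncNorm p r c k) q natLogMeasure := by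
  have hpos : ∀ᵐ k ∂(Measure.count.restrict (Ici 1) : Measure ℕ), 1 ≤ k :=
    ae_restrict_mem (by measurability)
  rw [natLogMeasure, eLpNorm_withDensity (by fun_prop) (by simp)
    (hpos.mono fun k hk => by simp; omega) hq, seqLNorm]
  refine eLpNorm_congr_ae (hpos.mono fun k hk => ?_)
  have hk0 : (0 : ℝ) < k := by exact_mod_cast hk
  simp only
  rw [← mul_assoc, ENNReal.ofReal_mul (by positivity), Real.rpow_neg hk0.le,
    ← Real.inv_rpow hk0.le, ← ENNReal.ofReal_rpow_of_pos (by positivity),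
    ← ENNReal.ofReal_rpow_of_pos (by positivity), ENNReal.ofReal_inv_of_pos hk0,
    ENNReal.ofReal_natCast, truncNorm]

lemma log_natLog_bounds {k : ℕ} (hk : 1 ≤ k) :
    ENNReal.ofReal (1 + Real.log k) ≤ 2 * (1 + Nat.log 2 k) ∧
      (1 + Nat.log 2 k : ℝ≥0∞) ≤ 2 * ENNReal.ofReal (1 + Real.log k) := by
  have hk0 : (0 : ℝ) < k := by exact_mod_cast hk
  have hlog2 := Real.log_two_gt_d9
  have hlog2' := Real.log_two_lt_d9
  have hm : (0 : ℝ) ≤ Nat.log 2 k := Nat.cast_nonneg _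
  have hlow : Nat.log 2 k * Real.log 2 ≤ Real.log k := by
    rw [← Real.log_pow]
    exact Real.log_le_log (by positivity) (by exact_mod_cast Nat.pow_log_le_self 2 (by omega))
  have hupp : Real.log k ≤ (Nat.log 2 k + 1 : ℕ) * Real.log 2 := by
    rw [← Real.log_pow]
    exact Real.log_le_log hk0 (by exact_mod_cast (Nat.lt_pow_succ_log_self one_lt_two k).le)
  have hcast : (1 + Nat.log 2 k : ℝ≥0∞) = ENNReal.ofReal (1 + Nat.log 2 k) := by
    rw [ENNReal.ofReal_add zero_le_one hm, ENNReal.ofReal_one, ENNReal.ofReal_natCast]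
  push_cast at hupp
  rw [hcast, ← ENNReal.ofReal_ofNat, ← ENNReal.ofReal_mul zero_le_two,
    ← ENNReal.ofReal_mul zero_le_two]
  constructor <;> exact ENNReal.ofReal_le_ofReal (by nlinarith)

lemma seqLNorm_le_levelNorm {ι : Type*} {p q r : ℝ≥0∞} (hq : q ≠ 0) (β : ℝ) (c : ι → ℂ) :
    seqLNorm p q β r c ≤ 2 ^ |β| * levelNorm q β fun m => truncNorm p r c (2 ^ (m + 1)) := by
  set G : ℕ → ℝ≥0∞ := fun m => levelWeight β m * truncNorm p r c (2 ^ (m + 1))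
  have hpoint : ∀ k : ℕ, 1 ≤ k →
      ENNReal.ofReal (1 + Real.log k) ^ β * truncNorm p r c k ≤ 2 ^ |β| * G (Nat.log 2 k) := by
    intro k hk
    rw [← mul_assoc]
    gcongr
    · exact rpow_le_rpow_abs_mul_rpow two_ne_zero ENNReal.ofNat_ne_top (log_natLog_bounds hk).1
        (log_natLog_bounds hk).2 β
    · exact truncNorm_mono p r c (Nat.lt_pow_succ_log_self one_lt_two k).le
  calc seqLNorm p q β r c
      ≤ eLpNorm (fun k : ℕ => 2 ^ |β| * G (Nat.log 2 k)) q natLogMeasure := by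
        rw [seqLNorm_eq_eLpNorm_natLogMeasure hq]
        exact eLpNorm_mono_enorm_ae (natLogMeasure_ae_pos.mono hpoint)
    _ ≤ 2 ^ |β| * eLpNorm (G ∘ Nat.log 2) q natLogMeasure :=
        eLpNorm_const_mul_le _ (by finiteness) _
    _ ≤ 2 ^ |β| * eLpNorm G q Measure.count := by
        gcongr
        rw [← eLpNorm_map_measure (by fun_prop) (by fun_prop)]
        exact eLpNorm_mono_measure _ map_log_natLogMeasure_le

/-- The measure `dt/t` on `(0,1)`, which absorbs the factor `t^{-1/q}` of the norm of
`L_{p,q}(log L)_α`. -/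
def unitLogMeasure : Measure ℝ :=
  (volume.restrict (Ioo 0 1)).withDensity fun t => ENNReal.ofReal t⁻¹

lemma unitLogMeasure_ae_mem : ∀ᵐ t ∂unitLogMeasure, t ∈ Ioo (0 : ℝ) 1 :=
  (withDensity_absolutelyContinuous _ _).ae_le (ae_restrict_mem measurableSet_Ioo)

lemma lorentzZygmundNorm_eq_eLpNorm_unitLogMeasure {p q : ℝ≥0∞} (hq : q ≠ 0) (α : ℝ)
    (f : ℝ → ℂ) : lorentzZygmundNorm p q α f = eLpNorm (fun t =>
      ENNReal.ofReal t ^ p⁻¹.toReal * ENNReal.ofReal (1 + |Real.log t|) ^ α * rearrangement f t)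
      q unitLogMeasure := by
  have hmem : ∀ᵐ t ∂(volume.restrict (Ioo (0 : ℝ) 1)), t ∈ Ioo (0 : ℝ) 1 :=
    ae_restrict_mem measurableSet_Ioo
  rw [unitLogMeasure, eLpNorm_withDensity (by fun_prop)
    (hmem.mono fun t ht => by simpa using ht.1) (by simp) hq, lorentzZygmundNorm]
  refine eLpNorm_congr_ae (hmem.mono fun t ht => ?_)
  have ht0 : 0 < t := ht.1
  simp only
  rw [← mul_assoc, ← mul_assoc, sub_eq_add_neg, add_comm, Real.rpow_add ht0, Real.rpow_neg ht0.le,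
    ← Real.inv_rpow ht0.le, ENNReal.ofReal_mul (by positivity), ENNReal.ofReal_mul (by positivity),
    ENNReal.ofReal_rpow_of_pos (by positivity), ENNReal.ofReal_rpow_of_pos ht0,
    ENNReal.ofReal_rpow_of_pos (by positivity)]

/-- The index `j` of the dyadic interval `(2^{-(j+1)}, 2^{-j}]` containing `t ∈ (0,1)`. -/
def dyadicLevel (t : ℝ) : ℕ := ⌊-Real.logb 2 t⌋₊

lemma measurable_dyadicLevel : Measurable dyadicLevel :=
  Nat.measurable_floor.comp (Real.measurable_log.div_const _).neg

lemma dyadicLevel_eq_iff {t : ℝ} (ht : t ∈ Ioo (0 : ℝ) 1) (j : ℕ) :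
    dyadicLevel t = j ↔ t ∈ Ioc ((2⁻¹ : ℝ) ^ (j + 1)) (2⁻¹ ^ j) := by
  have hlog : 0 ≤ -Real.logb 2 t := neg_nonneg.2 (Real.logb_nonpos one_lt_two ht.1.le ht.2.le)
  have hpow : ∀ n : ℕ, (2⁻¹ : ℝ) ^ n = 2 ^ (-(n : ℝ)) := fun n => by
    rw [Real.rpow_neg zero_le_two, Real.rpow_natCast, inv_pow]
  rw [dyadicLevel, Nat.floor_eq_iff hlog, mem_Ioc, hpow, hpow,
    ← Real.lt_logb_iff_rpow_lt one_lt_two ht.1, ← Real.logb_le_iff_le_rpow one_lt_two ht.1,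
    Nat.cast_add_one, le_neg, neg_lt, and_comm]

lemma count_le_two_smul_map_dyadicLevel :
    Measure.count ≤ (2 : ℝ≥0∞) • unitLogMeasure.map dyadicLevel := by
  refine measure_le_of_singleton_le fun j => ?_
  set I := Ioo ((2⁻¹ : ℝ) ^ (j + 1)) (2⁻¹ ^ j) with hI
  have hI01 : I ⊆ Ioo 0 1 :=
    Ioo_subset_Ioo (by positivity) (pow_le_one₀ (by norm_num) (by norm_num))
  have hsub : I ⊆ dyadicLevel ⁻¹' {j} := fun t ht =>
    (dyadicLevel_eq_iff (hI01 ht) j).2 (Ioo_subset_Ioc_self ht)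
  have hmass : 1 ≤ 2 * unitLogMeasure I := calc
    (1 : ℝ≥0∞) = 2 * (ENNReal.ofReal (2⁻¹ ^ j)⁻¹ * volume I) := by
        rw [hI, Real.volume_Ioo, ← ENNReal.ofReal_mul (by positivity), ← ENNReal.ofReal_ofNat,
          ← ENNReal.ofReal_mul zero_le_two, ← ENNReal.ofReal_one]
        congr 1
        field_simp
        ring
    _ ≤ 2 * unitLogMeasure I := by
        rw [unitLogMeasure, withDensity_apply _ measurableSet_Ioo, Measure.restrict_restrict
          measurableSet_Ioo, inter_eq_left.2 hI01, ← setLIntegral_const]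
        gcongr 2 * ?_
        refine setLIntegral_mono' measurableSet_Ioo fun t ht => ENNReal.ofReal_le_ofReal ?_
        exact inv_anti₀ (hI01 ht).1 ht.2.le
  rw [Measure.count_singleton, Measure.smul_apply, smul_eq_mul,
    Measure.map_apply measurable_dyadicLevel (by measurability)]
  exact hmass.trans (by gcongr)

/-- The sequence `2^{-j/2} f^*(2^{-j})`, which discretizes `t^{1/2} f^*(t)`. -/
def dyadicSample (f : ℝ → ℂ) (j : ℕ) : ℝ≥0∞ :=
  2⁻¹ ^ ((j : ℝ) / 2) * rearrangement f (2⁻¹ ^ j)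

lemma rearrangement_antitone (f : ℝ → ℂ) : Antitone (rearrangement f) :=
  fun _ _ h => sInf_le_sInf fun _ hs => hs.trans (ENNReal.ofReal_le_ofReal h)

lemma log_dyadicLevel_bounds {t : ℝ} (ht : t ∈ Ioo (0 : ℝ) 1) :
    ENNReal.ofReal (1 + |Real.log t|) ≤ 2 * (1 + dyadicLevel t) ∧
      (1 + dyadicLevel t : ℝ≥0∞) ≤ 2 * ENNReal.ofReal (1 + |Real.log t|) := by
  have hlog2 := Real.log_two_gt_d9
  have hlog2' := Real.log_two_lt_d9
  have hj : (0 : ℝ) ≤ dyadicLevel t := Nat.cast_nonneg _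
  have habs : |Real.log t| = -Real.log t := abs_of_neg (Real.log_neg ht.1 ht.2)
  have hmul : -Real.logb 2 t * Real.log 2 = -Real.log t := by
    rw [neg_mul, Real.logb, div_mul_cancel₀ _ (by positivity)]
  have hlow : dyadicLevel t ≤ -Real.logb 2 t :=
    Nat.floor_le (neg_nonneg.2 (Real.logb_nonpos one_lt_two ht.1.le ht.2.le))
  have hupp : -Real.logb 2 t < dyadicLevel t + 1 := Nat.lt_floor_add_one _
  have hcast : (1 + dyadicLevel t : ℝ≥0∞) = ENNReal.ofReal (1 + dyadicLevel t) := by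
    rw [ENNReal.ofReal_add zero_le_one hj, ENNReal.ofReal_one, ENNReal.ofReal_natCast]
  rw [hcast, habs, ← hmul, ← ENNReal.ofReal_ofNat, ← ENNReal.ofReal_mul zero_le_two,
    ← ENNReal.ofReal_mul zero_le_two]
  constructor <;> exact ENNReal.ofReal_le_ofReal (by nlinarith)

lemma dyadicSample_dyadicLevel_le (f : ℝ → ℂ) {t : ℝ} (ht : t ∈ Ioo (0 : ℝ) 1) :
    dyadicSample f (dyadicLevel t) ≤
      2 ^ (1 / 2 : ℝ) * (ENNReal.ofReal t ^ (1 / 2 : ℝ) * rearrangement f t) := by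
  obtain ⟨hlow, hupp⟩ := (dyadicLevel_eq_iff ht _).1 rfl
  rw [pow_succ] at hlow
  have hpow : (2⁻¹ : ℝ≥0∞) ^ ((dyadicLevel t : ℝ) / 2) ≤ (2 * ENNReal.ofReal t) ^ (1 / 2 : ℝ) := by
    rw [div_eq_mul_one_div, ENNReal.rpow_mul, ENNReal.rpow_natCast, ← ENNReal.ofReal_ofNat,
      ← ENNReal.ofReal_inv_of_pos two_pos, ← ENNReal.ofReal_pow (by positivity),
      ← ENNReal.ofReal_mul zero_le_two]
    gcongr
    linarith
  rw [← mul_assoc, ← ENNReal.mul_rpow_of_nonneg _ _ (by positivity), dyadicSample]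
  gcongr
  exact rearrangement_antitone f hupp

lemma exists_levelNorm_dyadicSample_le {q : ℝ≥0∞} (hq : q ≠ 0) (α : ℝ) : ∃ C : ℝ≥0,
    ∀ f, levelNorm q α (dyadicSample f) ≤ C * lorentzZygmundNorm 2 q α f := by
  refine ⟨2 ^ q⁻¹.toReal * (2 ^ |α| * 2 ^ (1 / 2 : ℝ)), fun f => ?_⟩
  set F : ℕ → ℝ≥0∞ := fun j => levelWeight α j * dyadicSample f j
  set G : ℝ → ℝ≥0∞ := fun t => ENNReal.ofReal t ^ (2 : ℝ≥0∞)⁻¹.toReal *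
    ENNReal.ofReal (1 + |Real.log t|) ^ α * rearrangement f t with hG
  have hpoint : ∀ t ∈ Ioo (0 : ℝ) 1,
      F (dyadicLevel t) ≤ 2 ^ |α| * 2 ^ (1 / 2 : ℝ) * G t := fun t ht => calc
    F (dyadicLevel t) ≤ 2 ^ |α| * ENNReal.ofReal (1 + |Real.log t|) ^ α *
        (2 ^ (1 / 2 : ℝ) * (ENNReal.ofReal t ^ (1 / 2 : ℝ) * rearrangement f t)) := by
        refine mul_le_mul' ?_ (dyadicSample_dyadicLevel_le f ht)
        exact rpow_le_rpow_abs_mul_rpow two_ne_zero ENNReal.ofNat_ne_top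
          (log_dyadicLevel_bounds ht).2 (log_dyadicLevel_bounds ht).1 α
    _ = 2 ^ |α| * 2 ^ (1 / 2 : ℝ) * G t := by
        simp only [hG, ENNReal.toReal_inv, ENNReal.toReal_ofNat, one_div]
        ring
  calc levelNorm q α (dyadicSample f)
      ≤ eLpNorm F q ((2 : ℝ≥0∞) • unitLogMeasure.map dyadicLevel) :=
        eLpNorm_mono_measure _ count_le_two_smul_map_dyadicLevel
    _ = 2 ^ q⁻¹.toReal * eLpNorm (F ∘ dyadicLevel) q unitLogMeasure := by
        rw [eLpNorm_smul_measure_of_ne_zero two_ne_zero, smul_eq_mul,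
          eLpNorm_map_measure (by fun_prop) measurable_dyadicLevel.aemeasurable]
        simp
    _ ≤ 2 ^ q⁻¹.toReal * (2 ^ |α| * 2 ^ (1 / 2 : ℝ) * eLpNorm G q unitLogMeasure) := by
        gcongr
        refine le_trans (eLpNorm_mono_enorm_ae (unitLogMeasure_ae_mem.mono hpoint))
          (eLpNorm_const_mul_le _ (by finiteness) _)
    _ = _ := by
        simp only [lorentzZygmundNorm_eq_eLpNorm_unitLogMeasure hq, hG, ← mul_assoc,
          ENNReal.coe_mul, ENNReal.coe_rpow_of_ne_zero two_ne_zero, ENNReal.coe_ofNat]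

/-! ### Rearrangements of sequences -/

section SeqRearrangement

variable {ι : Type*} {c d e : ι → ℂ} {p E : ℝ≥0∞}

lemma le_encard_of_lt_seqRearrangement {s : ℝ≥0∞} {i : ℕ} (h : s < seqRearrangement c i) :
    (i : ℕ∞) ≤ {n | s < ‖c n‖ₑ}.encard :=
  not_lt.1 fun hlt => h.not_ge (sInf_le hlt)

lemma seqRearrangement_le_of_forall_le (h : ∀ n, ‖c n‖ₑ ≤ E) {i : ℕ} (hi : 1 ≤ i) :
    seqRearrangement c i ≤ E := by
  refine sInf_le ?_
  have hempty : {n | E < ‖c n‖ₑ} = ∅ := eq_empty_of_forall_notMem fun n hn => hn.not_ge (h n)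
  rw [mem_ofPred_eq, hempty, encard_empty]
  exact_mod_cast hi

lemma seqRearrangement_add_le (he : ∀ n, ‖e n‖ₑ ≤ E) (i : ℕ) :
    seqRearrangement (d + e) i ≤ seqRearrangement d i + E := by
  rw [seqRearrangement, seqRearrangement, ENNReal.sInf_add]
  refine le_iInf₂ fun s hs => sInf_le (lt_of_le_of_lt (encard_le_encard fun n hn => ?_) hs)
  by_contra hle
  refine (show s + E < ‖d n + e n‖ₑ from hn).not_ge ?_
  rw [mem_ofPred_eq, not_lt] at hle
  exact (enorm_add_le _ _).trans (add_le_add hle (he n))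

lemma exists_finset_sum_rpow_le {r : ℝ} (hr : 0 < r) (l : ℕ → ℝ≥0∞) (k : ℕ)
    (h : ∀ i ∈ Finset.Icc 1 k, l i = 0 ∨ l i < seqRearrangement d i) :
    ∃ F : Finset ι, F.card ≤ k ∧ ∑ i ∈ Finset.Icc 1 k, l i ^ r ≤ ∑ n ∈ F, ‖d n‖ₑ ^ r := by
  classical
  induction k with
  | zero => exact ⟨∅, by simp⟩
  | succ k ih =>
    obtain ⟨F, hcard, hsum⟩ := ih fun i hi => h i (Finset.Icc_subset_Icc_right k.le_succ hi)
    rw [Finset.sum_Icc_succ_top (by omega)]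
    rcases h (k + 1) (by simp) with h0 | hlt
    · exact ⟨F, by omega, by simpa [h0, hr] using hsum⟩
    obtain ⟨n, hn, hnF⟩ : ∃ n ∈ {n | l (k + 1) < ‖d n‖ₑ}, n ∉ (F : Set ι) := by
      refine not_subset.1 fun hsub => ?_
      have hle := (le_encard_of_lt_seqRearrangement hlt).trans (encard_le_encard hsub)
      rw [encard_coe_eq_coe_finsetCard, Nat.cast_le] at hle
      omega
    have hnF' : n ∉ F := hnF
    refine ⟨insert n F, by rw [Finset.card_insert_of_notMem hnF']; omega, ?_⟩
    rw [Finset.sum_insert hnF', add_comm]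
    exact add_le_add (ENNReal.rpow_le_rpow hn.le hr.le) hsum

lemma sum_seqRearrangement_rpow_le {r : ℝ} (hr : 0 < r) (d : ι → ℂ) (k : ℕ) :
    ∑ i ∈ Finset.Icc 1 k, seqRearrangement d i ^ r ≤ ∑' n, ‖d n‖ₑ ^ r := by
  rcases eq_or_ne (∑' n, ‖d n‖ₑ ^ r) ∞ with htop | hfin
  · exact htop ▸ le_top
  have hbound : ∀ n, ‖d n‖ₑ ≤ (∑' n, ‖d n‖ₑ ^ r) ^ r⁻¹ := fun n =>
    (ENNReal.le_rpow_inv_iff hr).2 (ENNReal.le_tsum n)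
  have hne_top : ∀ i ∈ Finset.Icc 1 k, seqRearrangement d i ≠ ∞ := fun i hi =>
    ne_top_of_le_ne_top (ENNReal.rpow_ne_top_of_nonneg (by positivity) hfin)
      (seqRearrangement_le_of_forall_le hbound (Finset.mem_Icc.1 hi).1)
  refine ENNReal.le_of_forall_lt_one_mul_le fun θ hθ => ?_
  obtain ⟨F, -, hF⟩ := exists_finset_sum_rpow_le (d := d) hr
    (fun i => θ ^ r⁻¹ * seqRearrangement d i) k fun i hi => by
      refine or_iff_not_imp_left.2 fun h0 => ?_
      have h0' := (mul_ne_zero_iff.1 h0).2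
      simpa using (ENNReal.mul_lt_mul_iff_left h0' (hne_top i hi)).2
        (ENNReal.rpow_lt_one hθ (inv_pos.2 hr))
  simp only [ENNReal.mul_rpow_of_nonneg _ _ hr.le, ENNReal.rpow_inv_rpow hr.ne',
    ← Finset.mul_sum] at hF
  exact hF.trans (ENNReal.sum_le_tsum F)

lemma truncNorm_self_eq (p : ℝ≥0∞) (c : ι → ℂ) (k : ℕ) :
    truncNorm p p c k = eLpNorm (seqRearrangement c) p (Measure.count.restrict (Icc 1 k)) := by
  simp only [truncNorm, sub_self, Real.rpow_zero, ENNReal.ofReal_one, one_mul]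

lemma truncNorm_self_le (hp0 : p ≠ 0) (hpt : p ≠ ∞) (d : ι → ℂ) (k : ℕ) :
    truncNorm p p d k ≤ (∑' n, ‖d n‖ₑ ^ p.toReal) ^ (1 / p.toReal) := by
  rw [truncNorm_self_eq, eLpNorm_eq_lintegral_rpow_enorm_toReal hp0 hpt, ← Finset.coe_Icc,
    lintegral_finset]
  simp only [Measure.count_singleton, mul_one, enorm_eq_self]
  gcongr
  exact sum_seqRearrangement_rpow_le (ENNReal.toReal_pos hp0 hpt) d k

lemma truncNorm_self_add_le (hp : 1 ≤ p) (he : ∀ n, ‖e n‖ₑ ≤ E) (k : ℕ) :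
    truncNorm p p (d + e) k ≤ truncNorm p p d k + E * (k : ℝ≥0∞) ^ (1 / p.toReal) := by
  simp only [truncNorm_self_eq]
  set ν : Measure ℕ := Measure.count.restrict (Icc 1 k) with hν
  have hν_univ : ν univ = k := by
    rw [hν, Measure.restrict_apply_univ, ← Finset.coe_Icc, Measure.count_apply_finset,
      Nat.card_Icc, Nat.add_sub_cancel]
  calc eLpNorm (seqRearrangement (d + e)) p ν
      ≤ eLpNorm (seqRearrangement d + fun _ => E) p ν :=
        eLpNorm_mono_enorm (seqRearrangement_add_le he)
    _ ≤ eLpNorm (seqRearrangement d) p ν + eLpNorm (fun _ => E) p ν :=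
        eLpNorm_add_le (by fun_prop) (by fun_prop) hp
    _ ≤ eLpNorm (seqRearrangement d) p ν + E * (k : ℝ≥0∞) ^ (1 / p.toReal) := by
        gcongr
        refine (eLpNorm_le_of_ae_enorm_bound (.of_forall fun _ => le_rfl)).trans ?_
        simp [hν_univ]

end SeqRearrangement

/-! ### Splitting a function at a level of its rearrangement -/

section Splitting

instance : IsProbabilityMeasure μI := ⟨by simp⟩

variable {f : ℝ → ℂ}

lemma rearrangement_one (f : ℝ → ℂ) : rearrangement f 1 = 0 := by
  refine le_antisymm (sInf_le ?_) zero_le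
  simpa using prob_le_one (μ := μI)

lemma measure_rearrangement_lt_enorm_le (f : ℝ → ℂ) (t : ℝ) :
    μI {x | rearrangement f t < ‖f x‖ₑ} ≤ ENNReal.ofReal t := by
  rcases eq_or_ne (rearrangement f t) ∞ with htop | hfin
  · simp [htop]
  obtain ⟨u, hanti, hu, hlim⟩ := exists_seq_strictAnti_tendsto' (lt_top_iff_ne_top.2 hfin)
  have hunion : {x | rearrangement f t < ‖f x‖ₑ} = ⋃ n, {x | u n < ‖f x‖ₑ} := by
    ext x
    simp only [mem_ofPred_eq, mem_iUnion]
    exact ⟨fun hx => (hlim.eventually_lt_const hx).exists, fun ⟨n, hn⟩ => (hu n).1.trans hn⟩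
  have hmono : Monotone fun n => {x | u n < ‖f x‖ₑ} :=
    fun i j hij x (hx : u i < _) => (hanti.antitone hij).trans_lt hx
  rw [hunion, hmono.measure_iUnion]
  refine iSup_le fun n => ?_
  obtain ⟨s, hs, hlt⟩ := sInf_lt_iff.1 (hu n).1
  exact (measure_mono fun x (hx : u n < _) => hlt.trans hx).trans hs

/-- The set, of measure at most `2^{-n}`, on which `|f|` is above the level `f^*(2^{-n})`. -/
def peakSet (f : ℝ → ℂ) (n : ℕ) : Set ℝ := {x | rearrangement f (2⁻¹ ^ n) < ‖f x‖ₑ}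

lemma nullMeasurableSet_peakSet (hf : AEStronglyMeasurable f μI) (n : ℕ) :
    NullMeasurableSet (peakSet f n) μI :=
  nullMeasurableSet_lt aemeasurable_const hf.enorm

lemma notMem_peakSet {n : ℕ} {x : ℝ} :
    x ∉ peakSet f n ↔ ‖f x‖ₑ ≤ rearrangement f (2⁻¹ ^ n) := by
  rw [peakSet, mem_ofPred_eq, not_lt]

lemma measure_peakSet_le (f : ℝ → ℂ) (n : ℕ) : μI (peakSet f n) ≤ 2⁻¹ ^ n := by
  refine (measure_rearrangement_lt_enorm_le f _).trans_eq ?_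
  rw [ENNReal.ofReal_pow (by positivity), ENNReal.ofReal_inv_of_pos two_pos, ENNReal.ofReal_ofNat]

lemma ae_exists_notMem_peakSet (f : ℝ → ℂ) : ∀ᵐ x ∂μI, ∃ n, x ∉ peakSet f n := by
  simp only [ae_iff, not_exists, not_not]
  refine le_antisymm (ge_of_tendsto' (ENNReal.tendsto_pow_atTop_nhds_zero_of_lt_one
    ENNReal.one_half_lt_one) fun n => ?_) zero_le
  exact (measure_mono fun x (hx : ∀ m, x ∈ peakSet f m) => hx n).trans (measure_peakSet_le f n)

lemma lintegral_comp_enorm_le (hf : AEStronglyMeasurable f μI) {h : ℝ≥0∞ → ℝ≥0∞}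
    (hmono : Monotone h) (h0 : h 0 = 0) :
    ∫⁻ x, h ‖f x‖ₑ ∂μI ≤ 2 * ∑' j : ℕ, 2⁻¹ ^ j * h (rearrangement f (2⁻¹ ^ j)) := by
  have hpoint : ∀ᵐ x ∂μI, h ‖f x‖ₑ ≤
      ∑' j : ℕ, (peakSet f j).indicator (fun _ => h (rearrangement f (2⁻¹ ^ (j + 1)))) x := by
    filter_upwards [ae_exists_notMem_peakSet f] with x hx
    classical
    have hle := notMem_peakSet.1 (Nat.find_spec hx)
    rcases hj : Nat.find hx with - | j
    · rw [hj, pow_zero, rearrangement_one, nonpos_iff_eq_zero] at hle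
      rw [hle, h0]
      exact zero_le
    · have hmem : x ∈ peakSet f j := not_not.1 (Nat.find_min hx (hj ▸ j.lt_succ_self))
      refine le_trans ?_ (ENNReal.le_tsum j)
      rw [indicator_of_mem hmem]
      exact hmono (hj ▸ hle)
  calc ∫⁻ x, h ‖f x‖ₑ ∂μI
      ≤ ∑' j : ℕ, ∫⁻ x,
          (peakSet f j).indicator (fun _ => h (rearrangement f (2⁻¹ ^ (j + 1)))) x ∂μI := by
        rw [← lintegral_tsum fun j =>
          aemeasurable_const.indicator₀ (nullMeasurableSet_peakSet hf j)]
        exact lintegral_mono_ae hpoint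
    _ ≤ ∑' j : ℕ, 2 * (2⁻¹ ^ (j + 1) * h (rearrangement f (2⁻¹ ^ (j + 1)))) := by
        refine ENNReal.tsum_le_tsum fun j => (lintegral_indicator_const_le _ _).trans ?_
        have htwo : (2 : ℝ≥0∞) * 2⁻¹ ^ (j + 1) = 2⁻¹ ^ j := by
          rw [pow_succ', ← mul_assoc, ENNReal.mul_inv_cancel (by simp) (by simp), one_mul]
        rw [← mul_assoc, htwo, mul_comm]
        gcongr
        exact measure_peakSet_le f j
    _ ≤ 2 * ∑' j : ℕ, 2⁻¹ ^ j * h (rearrangement f (2⁻¹ ^ j)) := by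
        rw [ENNReal.tsum_mul_left]
        refine mul_le_mul_right ?_ 2
        exact ENNReal.tsum_comp_le_tsum_of_injective (add_left_injective 1)
          fun j => 2⁻¹ ^ j * h (rearrangement f (2⁻¹ ^ j))

lemma rearrangement_pow_mono (f : ℝ → ℂ) : Monotone fun j : ℕ => rearrangement f (2⁻¹ ^ j) :=
  fun _ _ h => rearrangement_antitone f (pow_le_pow_of_le_one (by norm_num) (by norm_num) h)

lemma half_pow_mul_rearrangement (f : ℝ → ℂ) (j : ℕ) :
    2⁻¹ ^ j * rearrangement f (2⁻¹ ^ j) = 2⁻¹ ^ ((j : ℝ) / 2) * dyadicSample f j := by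
  rw [dyadicSample, ← mul_assoc, ← ENNReal.rpow_add _ _ (by simp) (by simp), add_halves,
    ENNReal.rpow_natCast]

lemma half_pow_mul_rearrangement_sq (f : ℝ → ℂ) (j : ℕ) :
    2⁻¹ ^ j * rearrangement f (2⁻¹ ^ j) ^ (2 : ℝ) = dyadicSample f j ^ (2 : ℝ) := by
  rw [dyadicSample, ENNReal.mul_rpow_of_nonneg _ _ zero_le_two, ← ENNReal.rpow_mul,
    div_mul_cancel₀ _ two_ne_zero, ENNReal.rpow_natCast]

lemma lintegral_indicator_peakSet_le (hf : AEStronglyMeasurable f μI) (n : ℕ) :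
    ∫⁻ x, ‖(peakSet f n).indicator f x‖ₑ ∂μI ≤
      2 * (2⁻¹ ^ ((n : ℝ) / 2) * dyadicTail (dyadicSample f) n) := by
  set R : ℕ → ℝ≥0∞ := fun j => rearrangement f (2⁻¹ ^ j) with hR
  have hRmono : Monotone R := rearrangement_pow_mono f
  set h : ℝ≥0∞ → ℝ≥0∞ := (Ioi (R n)).indicator id with hh
  have hmono : Monotone h := fun x y hxy => by
    by_cases hx : x ∈ Ioi (R n)
    · simpa [hh, indicator_of_mem hx, indicator_of_mem (show y ∈ Ioi (R n) from hx.trans_le hxy)]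
    · simp [hh, indicator_of_notMem hx]
  have hcomp : ∀ x, ‖(peakSet f n).indicator f x‖ₑ = h ‖f x‖ₑ := fun x => by
    simp only [hh, peakSet, indicator_apply, mem_ofPred_eq, mem_Ioi, id, hR]
    split_ifs <;> simp
  have hlow : ∀ j, j < n → h (R j) = 0 := fun j hj =>
    indicator_of_notMem (not_lt.2 (hRmono hj.le)) _
  simp only [hcomp]
  refine (lintegral_comp_enorm_le hf hmono (by simp [hh])).trans ?_
  gcongr 2 * ?_
  calc ∑' j : ℕ, 2⁻¹ ^ j * h (R j) = ∑' i : ℕ, 2⁻¹ ^ (i + n) * h (R (i + n)) := by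
        rw [← Summable.sum_add_tsum_nat_add' (k := n) ENNReal.summable,
          Finset.sum_eq_zero fun j hj => by rw [hlow j (Finset.mem_range.1 hj), mul_zero], zero_add]
    _ ≤ ∑' i : ℕ, 2⁻¹ ^ ((n : ℝ) / 2) * (2⁻¹ ^ ((i : ℝ) / 2) * dyadicSample f (n + i)) := by
        refine ENNReal.tsum_le_tsum fun i => ?_
        rw [← mul_assoc, ← ENNReal.rpow_add _ _ (by simp) (by simp), ← add_div, ← Nat.cast_add,
          ← half_pow_mul_rearrangement, add_comm i n]
        gcongr
        exact indicator_le_self _ _ _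
    _ = 2⁻¹ ^ ((n : ℝ) / 2) * dyadicTail (dyadicSample f) n := ENNReal.tsum_mul_left

lemma lintegral_min_enorm_sq_le (hf : AEStronglyMeasurable f μI) (n : ℕ) :
    ∫⁻ x, min ‖f x‖ₑ (rearrangement f (2⁻¹ ^ n)) ^ (2 : ℝ) ∂μI ≤
      4 * ∑ j ∈ Finset.range (n + 1), dyadicSample f j ^ (2 : ℝ) := by
  set R : ℕ → ℝ≥0∞ := fun j => rearrangement f (2⁻¹ ^ j)
  set S := ∑ j ∈ Finset.range (n + 1), dyadicSample f j ^ (2 : ℝ)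
  have hmono : Monotone fun x : ℝ≥0∞ => min x (R n) ^ (2 : ℝ) := fun x y hxy =>
    ENNReal.rpow_le_rpow (min_le_min_right _ hxy) zero_le_two
  have hhead : ∑ j ∈ Finset.range (n + 1), 2⁻¹ ^ j * min (R j) (R n) ^ (2 : ℝ) ≤ S := by
    refine Finset.sum_le_sum fun j _ => ?_
    rw [← half_pow_mul_rearrangement_sq]
    gcongr
    exact min_le_left _ _
  have htail : ∑' i : ℕ, 2⁻¹ ^ (i + (n + 1)) * min (R (i + (n + 1))) (R n) ^ (2 : ℝ) ≤ S := calc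
    _ ≤ ∑' i : ℕ, 2⁻¹ ^ (i + 1) * (2⁻¹ ^ n * R n ^ (2 : ℝ)) := by
        refine ENNReal.tsum_le_tsum fun i => ?_
        rw [← mul_assoc, ← pow_add, add_right_comm, add_assoc]
        gcongr
        exact min_le_right _ _
    _ = dyadicSample f n ^ (2 : ℝ) := by
        rw [ENNReal.tsum_mul_right, ENNReal.tsum_geometric_add_one, half_pow_mul_rearrangement_sq,
          ENNReal.one_sub_inv_two, inv_inv, ENNReal.inv_mul_cancel (by simp) (by simp), one_mul]
    _ ≤ S := Finset.single_le_sum (f := fun j => dyadicSample f j ^ (2 : ℝ))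
        (fun _ _ => zero_le) (Finset.self_mem_range_succ n)
  calc ∫⁻ x, min ‖f x‖ₑ (R n) ^ (2 : ℝ) ∂μI
      ≤ 2 * ∑' j : ℕ, 2⁻¹ ^ j * min (R j) (R n) ^ (2 : ℝ) :=
        lintegral_comp_enorm_le hf hmono (by simp)
    _ ≤ 2 * (S + S) := by
        rw [← Summable.sum_add_tsum_nat_add' (k := n + 1) ENNReal.summable]
        gcongr
    _ = 4 * S := by ring

lemma eLpNorm_indicator_compl_peakSet_le (hf : AEStronglyMeasurable f μI) (n : ℕ) :
    eLpNorm ((peakSet f n)ᶜ.indicator f) 2 μI ≤ 2 * dyadicHead (dyadicSample f) n := by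
  have hpoint : ∀ x, ‖(peakSet f n)ᶜ.indicator f x‖ₑ ^ (2 : ℝ) ≤
      min ‖f x‖ₑ (rearrangement f (2⁻¹ ^ n)) ^ (2 : ℝ) := fun x => by
    by_cases hx : x ∈ peakSet f n
    · simp [hx]
    · rw [indicator_of_mem (show x ∈ (peakSet f n)ᶜ from hx), min_eq_left (notMem_peakSet.1 hx)]
  have hfour : (4 : ℝ≥0∞) = 2 ^ (2 : ℝ) := by norm_num
  rw [eLpNorm_eq_lintegral_rpow_enorm_toReal (by simp) (by simp), ENNReal.toReal_ofNat]
  calc (∫⁻ x, ‖(peakSet f n)ᶜ.indicator f x‖ₑ ^ (2 : ℝ) ∂μI) ^ (1 / 2 : ℝ)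
      ≤ (4 * ∑ j ∈ Finset.range (n + 1), dyadicSample f j ^ (2 : ℝ)) ^ (1 / 2 : ℝ) := by
        gcongr
        exact (lintegral_mono hpoint).trans (lintegral_min_enorm_sq_le hf n)
    _ = 2 * dyadicHead (dyadicSample f) n := by
        rw [ENNReal.mul_rpow_of_nonneg _ _ (by positivity), hfour, ← ENNReal.rpow_mul,
          mul_one_div_cancel two_ne_zero, ENNReal.rpow_one, dyadicHead]

lemma lintegral_enorm_le_dyadicTail (hf : AEStronglyMeasurable f μI) :
    ∫⁻ x, ‖f x‖ₑ ∂μI ≤ 2 * dyadicTail (dyadicSample f) 0 := by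
  have hpeak : (peakSet f 0).indicator f = f := by
    rw [indicator_eq_self]
    intro x hx
    simpa [peakSet, rearrangement_one] using hx
  simpa [hpeak] using lintegral_indicator_peakSet_le hf 0

end Splitting

/-! ### Fourier coefficients -/

lemma integrable_of_memLorentzZygmund {q : ℝ≥0∞} (hq : 1 ≤ q) {α : ℝ} {f : ℝ → ℂ}
    (hf : MemLorentzZygmund 2 q α f) : Integrable f μI := by
  have hq0 : q ≠ 0 := (zero_lt_one.trans_le hq).ne'
  obtain ⟨C, hC⟩ := exists_levelNorm_dyadicSample_le hq0 α
  obtain ⟨D, hD⟩ := exists_levelNorm_dyadicTail_le hq α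
  set b := dyadicSample f
  have hzero : dyadicTail b 0 ≤ levelNorm q α (dyadicTail b) := by
    simpa [levelNorm, levelWeight] using
      enorm_le_eLpNorm_count (fun n => levelWeight α n * dyadicTail b n) 0 hq0
  have htail : dyadicTail b 0 < ∞ := calc
    dyadicTail b 0 ≤ D * (C * lorentzZygmundNorm 2 q α f) :=
      hzero.trans ((hD b).trans (by gcongr; exact hC f))
    _ < ∞ := by have := hf.2; finiteness
  exact ⟨hf.1, (lintegral_enorm_le_dyadicTail hf.1).trans_lt (by finiteness)⟩

section Fourier

variable {ι : Type*} {φ : ι → Lp ℂ 2 μI} {M : ℝ} {f g : ℝ → ℂ}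

lemma integrable_mul_conj {ψ : Lp ℂ 2 μI} (hf : Integrable f μI) (hψ : ∀ᵐ x ∂μI, ‖ψ x‖ ≤ M) :
    Integrable (fun x => f x * starRingEnd ℂ (ψ x)) μI :=
  hf.mul_bdd (RCLike.continuous_conj.comp_aestronglyMeasurable (Lp.aestronglyMeasurable ψ))
    (hψ.mono fun x hx => by rwa [RCLike.norm_conj])

lemma coeffs_add {n : ι} (hφ : ∀ᵐ x ∂μI, ‖φ n x‖ ≤ M) (hf : Integrable f μI)
    (hg : Integrable g μI) : coeffs φ (f + g) n = coeffs φ f n + coeffs φ g n := by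
  simp only [coeffs, Pi.add_apply, add_mul]
  exact integral_add (integrable_mul_conj hf hφ) (integrable_mul_conj hg hφ)

lemma enorm_coeffs_le {n : ι} (hφ : ∀ᵐ x ∂μI, ‖φ n x‖ ≤ M) :
    ‖coeffs φ f n‖ₑ ≤ ENNReal.ofReal M * ∫⁻ x, ‖f x‖ₑ ∂μI := by
  rw [← lintegral_const_mul' _ _ ENNReal.ofReal_ne_top]
  refine (enorm_integral_le_lintegral_enorm _).trans (lintegral_mono_ae (hφ.mono fun x hx => ?_))
  rw [enorm_mul, mul_comm, ← ofReal_norm (starRingEnd ℂ _), RCLike.norm_conj]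
  gcongr

lemma coeffs_eq_inner (hf : MemLp f 2 μI) (n : ι) :
    coeffs φ f n = inner ℂ (φ n) (hf.toLp f) := by
  rw [L2.inner_def]
  refine integral_congr_ae (hf.coeFn_toLp.mono fun x hx => ?_)
  simp only [hx, RCLike.inner_apply]

/-- A system in `L_2(0,1)` satisfying Bessel's inequality and bounded by `M ≥ 1` in `L_∞(0,1)`:
the natural domain of the coefficient estimates, containing all bounded orthonormal systems. -/
structure IsBoundedBessel (φ : ι → Lp ℂ 2 μI) (M : ℝ) : Prop where
  one_le : 1 ≤ M
  ae_norm_le : ∀ n, ∀ᵐ x ∂μI, ‖φ n x‖ ≤ M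
  bessel : ∀ g : Lp ℂ 2 μI, ∑' n, ‖inner ℂ (φ n) g‖ₑ ^ 2 ≤ ‖g‖ₑ ^ 2

lemma tsum_enorm_inner_sq_le {E : Type*} [NormedAddCommGroup E] [InnerProductSpace ℂ E]
    {v : ι → E} (hv : Orthonormal ℂ v) (x : E) : ∑' n, ‖inner ℂ (v n) x‖ₑ ^ 2 ≤ ‖x‖ₑ ^ 2 := by
  rw [ENNReal.tsum_eq_iSup_sum]
  refine iSup_le fun F => ?_
  have hB := ENNReal.ofReal_le_ofReal (hv.sum_inner_products_le x (s := F))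
  rw [ENNReal.ofReal_sum_of_nonneg fun _ _ => by positivity] at hB
  simpa only [ENNReal.ofReal_pow (norm_nonneg _), ofReal_norm] using hB

lemma IsBoundedOrthonormal.isBoundedBessel [Nonempty ι] (h : IsBoundedOrthonormal φ M) :
    IsBoundedBessel φ M := by
  obtain ⟨horth, hsup⟩ := h
  have hle : ∀ n, eLpNorm (φ n) ∞ μI ≤ ENNReal.ofReal M := fun n =>
    hsup ▸ le_iSup (fun n => eLpNorm (φ n) ∞ μI) n
  have hM : 1 ≤ M := by
    obtain ⟨n⟩ := ‹Nonempty ι›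
    rw [← ENNReal.one_le_ofReal, ← ENNReal.ofReal_one, ← horth.1 n, ofReal_norm, Lp.enorm_def]
    exact (eLpNorm_le_eLpNorm_of_exponent_le le_top (Lp.aestronglyMeasurable _)).trans (hle n)
  refine ⟨hM, fun n => ?_, tsum_enorm_inner_sq_le horth⟩
  filter_upwards [enorm_ae_le_eLpNormEssSup (φ n) μI] with x hx
  rw [← ENNReal.ofReal_le_ofReal_iff (zero_le_one.trans hM), ofReal_norm]
  exact hx.trans (hle n)

lemma IsBoundedBessel.truncNorm_coeffs_le_eLpNorm (h : IsBoundedBessel φ M)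
    (hf : AEStronglyMeasurable f μI) (k : ℕ) :
    truncNorm 2 2 (coeffs φ f) k ≤ eLpNorm f 2 μI := by
  rcases eq_or_ne (eLpNorm f 2 μI) ∞ with htop | hfin
  · exact htop ▸ le_top
  have hmem : MemLp f 2 μI := ⟨hf, lt_top_iff_ne_top.2 hfin⟩
  have hB := h.bessel hmem.toLp
  rw [Lp.enorm_toLp] at hB
  calc truncNorm 2 2 (coeffs φ f) k
      ≤ (∑' n, ‖coeffs φ f n‖ₑ ^ (2 : ℝ)) ^ (1 / 2 : ℝ) := by
        simpa using truncNorm_self_le two_ne_zero ENNReal.ofNat_ne_top (coeffs φ f) k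
    _ ≤ (eLpNorm f 2 μI ^ (2 : ℝ)) ^ (1 / 2 : ℝ) := by
        simp only [coeffs_eq_inner hmem, ENNReal.rpow_ofNat]
        gcongr
    _ = eLpNorm f 2 μI := by
        rw [← ENNReal.rpow_mul, mul_one_div_cancel two_ne_zero, ENNReal.rpow_one]

lemma IsBoundedBessel.truncNorm_coeffs_le (h : IsBoundedBessel φ M) (hf : Integrable f μI)
    (k n : ℕ) : truncNorm 2 2 (coeffs φ f) k ≤ 2 * dyadicHead (dyadicSample f) n +
      ENNReal.ofReal M * (2 * (2⁻¹ ^ ((n : ℝ) / 2) * dyadicTail (dyadicSample f) n)) *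
        (k : ℝ≥0∞) ^ (1 / 2 : ℝ) := by
  have hA := nullMeasurableSet_peakSet hf.1 n
  have hlow : Integrable ((peakSet f n)ᶜ.indicator f) μI := hf.indicator₀ hA.compl
  have hpeak : Integrable ((peakSet f n).indicator f) μI := hf.indicator₀ hA
  have hsplit : coeffs φ f =
      coeffs φ ((peakSet f n)ᶜ.indicator f) + coeffs φ ((peakSet f n).indicator f) := by
    ext i
    rw [Pi.add_apply, ← coeffs_add (h.ae_norm_le i) hlow hpeak, indicator_compl_add_self]
  have hsmall : ∀ i, ‖coeffs φ ((peakSet f n).indicator f) i‖ₑ ≤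
      ENNReal.ofReal M * (2 * (2⁻¹ ^ ((n : ℝ) / 2) * dyadicTail (dyadicSample f) n)) := fun i =>
    (enorm_coeffs_le (h.ae_norm_le i)).trans
      (mul_le_mul_right (lintegral_indicator_peakSet_le hf.1 n) _)
  rw [hsplit]
  refine (truncNorm_self_add_le one_le_two hsmall k).trans ?_
  rw [ENNReal.toReal_ofNat]
  gcongr
  exact (h.truncNorm_coeffs_le_eLpNorm hlow.1 k).trans (eLpNorm_indicator_compl_peakSet_le hf.1 n)

lemma half_rpow_mul_two_pow_rpow (m : ℕ) :
    (2⁻¹ : ℝ≥0∞) ^ ((m : ℝ) / 2) * ((2 ^ m : ℕ) : ℝ≥0∞) ^ (1 / 2 : ℝ) = 1 := by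
  rw [div_eq_mul_one_div, ENNReal.rpow_mul, ENNReal.rpow_natCast, Nat.cast_pow, Nat.cast_ofNat,
    ← ENNReal.mul_rpow_of_nonneg _ _ (by norm_num), ← mul_pow,
    ENNReal.inv_mul_cancel two_ne_zero ENNReal.ofNat_ne_top, one_pow, ENNReal.one_rpow]

/-- Cutting `f` at the level `f^*(2^{-(m+a)})` instead of `f^*(2^{-m})` makes the peak smaller by a
factor `2^{-a/2}`, which compensates for the size `M` of the system. -/
lemma IsBoundedBessel.truncNorm_coeffs_two_pow_le (h : IsBoundedBessel φ M)
    (hf : Integrable f μI) {a : ℕ} {L : ℝ≥0∞} (hL : 1 ≤ L)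
    (hML : ENNReal.ofReal M * 2⁻¹ ^ ((a : ℝ) / 2) ≤ L) (m : ℕ) :
    truncNorm 2 2 (coeffs φ f) (2 ^ m) ≤ 2 * L *
      (dyadicHead (dyadicSample f) (m + a) + dyadicTail (dyadicSample f) (m + a)) := by
  set b := dyadicSample f
  have hpow : (2⁻¹ : ℝ≥0∞) ^ (((m + a : ℕ) : ℝ) / 2) * ((2 ^ m : ℕ) : ℝ≥0∞) ^ (1 / 2 : ℝ) =
      2⁻¹ ^ ((a : ℝ) / 2) := by
    rw [Nat.cast_add, add_div, ENNReal.rpow_add _ _ (by simp) (by simp), mul_right_comm,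
      half_rpow_mul_two_pow_rpow, one_mul]
  calc truncNorm 2 2 (coeffs φ f) (2 ^ m)
      ≤ 2 * dyadicHead b (m + a) + ENNReal.ofReal M * (2 * (2⁻¹ ^ (((m + a : ℕ) : ℝ) / 2) *
          dyadicTail b (m + a))) * ((2 ^ m : ℕ) : ℝ≥0∞) ^ (1 / 2 : ℝ) :=
        h.truncNorm_coeffs_le hf _ _
    _ = 2 * (1 * dyadicHead b (m + a) +
          ENNReal.ofReal M * 2⁻¹ ^ ((a : ℝ) / 2) * dyadicTail b (m + a)) := by
        rw [← hpow]
        ring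
    _ ≤ 2 * (L * dyadicHead b (m + a) + L * dyadicTail b (m + a)) := by gcongr
    _ = 2 * L * (dyadicHead b (m + a) + dyadicTail b (m + a)) := by ring

lemma levelNorm_comp_add_le (q : ℝ≥0∞) (α : ℝ) (b : ℕ → ℝ≥0∞) (i : ℕ) :
    levelNorm q α (fun m => b (m + i)) ≤ levelWeight |α| i * levelNorm q α b := calc
  levelNorm q α (fun m => b (m + i))
    ≤ eLpNorm (fun m => levelWeight |α| i * (levelWeight α (m + i) * b (m + i))) q
        Measure.count := by
      refine eLpNorm_mono_enorm fun m => ?_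
      rw [enorm_eq_self, enorm_eq_self, ← mul_assoc]
      gcongr
      exact levelWeight_le_mul_add α m i
  _ ≤ levelWeight |α| i * levelNorm q α b := by
      refine (eLpNorm_const_mul_le _ (levelWeight_ne_top _ _) _).trans ?_
      gcongr
      exact eLpNorm_count_comp_le (add_left_injective i) fun n => levelWeight α n * b n

lemma levelNorm_add_le {q : ℝ≥0∞} (hq : 1 ≤ q) (α : ℝ) (b c : ℕ → ℝ≥0∞) :
    levelNorm q α (b + c) ≤ levelNorm q α b + levelNorm q α c := by
  simp only [levelNorm, Pi.add_apply, mul_add]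
  exact eLpNorm_add_le (Measurable.of_discrete.aestronglyMeasurable)
    (Measurable.of_discrete.aestronglyMeasurable) hq

lemma levelNorm_mono_exponent (q : ℝ≥0∞) {α β : ℝ} (h : α ≤ β) (b : ℕ → ℝ≥0∞) :
    levelNorm q α b ≤ levelNorm q β b := by
  refine eLpNorm_mono_enorm fun n => ?_
  rw [enorm_eq_self, enorm_eq_self]
  gcongr
  exact ENNReal.rpow_le_rpow_of_exponent_le (by simp) h

lemma levelNorm_const_mul_le {c : ℝ≥0∞} (hc : c ≠ ∞) (q : ℝ≥0∞) (α : ℝ) (b : ℕ → ℝ≥0∞) :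
    levelNorm q α (fun n => c * b n) ≤ c * levelNorm q α b := by
  simp only [levelNorm, mul_left_comm _ c]
  exact eLpNorm_const_mul_le c hc _

lemma exists_levelNorm_dyadicHead_add_dyadicTail_le {q : ℝ≥0∞} {α : ℝ} (hq : 2 ≤ q)
    (hα : α < 1 / 2 - q⁻¹.toReal) : ∃ C : ℝ≥0, ∀ f,
      levelNorm q (α - 1 / 2) (dyadicHead (dyadicSample f) + dyadicTail (dyadicSample f)) ≤
        C * lorentzZygmundNorm 2 q α f := by
  have hq1 : 1 ≤ q := one_le_two.trans hq
  obtain ⟨A, hA⟩ := exists_levelNorm_dyadicHead_le hq hα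
  obtain ⟨B, hB⟩ := exists_levelNorm_dyadicTail_le hq1 α
  obtain ⟨D, hD⟩ := exists_levelNorm_dyadicSample_le (zero_lt_one.trans_le hq1).ne' α
  refine ⟨(A + B) * D, fun f => ?_⟩
  set b := dyadicSample f
  calc levelNorm q (α - 1 / 2) (dyadicHead b + dyadicTail b)
      ≤ levelNorm q (α - 1 / 2) (dyadicHead b) + levelNorm q (α - 1 / 2) (dyadicTail b) :=
        levelNorm_add_le hq1 _ _ _
    _ ≤ A * levelNorm q α b + B * levelNorm q α b := by
        gcongr
        · exact hA b
        · exact (levelNorm_mono_exponent q (by linarith) _).trans (hB b)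
    _ = (A + B) * levelNorm q α b := (add_mul _ _ _).symm
    _ ≤ (A + B) * (D * lorentzZygmundNorm 2 q α f) := by
        gcongr
        exact hD f
    _ = ((A + B) * D : ℝ≥0) * lorentzZygmundNorm 2 q α f := by
        push_cast
        ring

lemma exists_seqLNorm_coeffs_le_shift {q : ℝ≥0∞} {α : ℝ} (hq : 2 ≤ q)
    (hα : α < 1 / 2 - q⁻¹.toReal) : ∃ C : ℝ≥0, ∀ {ι : Type*} {φ : ι → Lp ℂ 2 μI} {M : ℝ} {f},
      IsBoundedBessel φ M → Integrable f μI → ∀ (a : ℕ) {L : ℝ≥0∞}, 1 ≤ L → L ≠ ∞ →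
      ENNReal.ofReal M * 2⁻¹ ^ ((a : ℝ) / 2) ≤ L →
        seqLNorm 2 q (α - 1 / 2) 2 (coeffs φ f) ≤
          C * (levelWeight |α - 1 / 2| (a + 1) * L) * lorentzZygmundNorm 2 q α f := by
  obtain ⟨C, hC⟩ := exists_levelNorm_dyadicHead_add_dyadicTail_le hq hα
  refine ⟨2 ^ |α - 1 / 2| * 2 * C, fun {ι φ M f} h hf a L hL hLt hML => ?_⟩
  set S := dyadicHead (dyadicSample f) + dyadicTail (dyadicSample f)
  have hS : ∀ m, truncNorm 2 2 (coeffs φ f) (2 ^ (m + 1)) ≤ 2 * L * S (m + (a + 1)) := fun m => by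
    rw [add_comm a 1, ← add_assoc]
    exact h.truncNorm_coeffs_two_pow_le hf hL hML (m + 1)
  calc seqLNorm 2 q (α - 1 / 2) 2 (coeffs φ f)
      ≤ 2 ^ |α - 1 / 2| * levelNorm q (α - 1 / 2) fun m =>
          truncNorm 2 2 (coeffs φ f) (2 ^ (m + 1)) :=
        seqLNorm_le_levelNorm (two_pos.trans_le hq).ne' _ _
    _ ≤ 2 ^ |α - 1 / 2| * levelNorm q (α - 1 / 2) fun m => 2 * L * S (m + (a + 1)) := by
        gcongr
        exact eLpNorm_mono_enorm fun m => mul_le_mul_right (hS m) _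
    _ ≤ 2 ^ |α - 1 / 2| * (2 * L * (levelWeight |α - 1 / 2| (a + 1) *
          (C * lorentzZygmundNorm 2 q α f))) := by
        gcongr
        refine (levelNorm_const_mul_le (by finiteness) _ _ _).trans ?_
        gcongr
        refine (levelNorm_comp_add_le _ _ S _).trans ?_
        gcongr
        exact hC f
    _ = _ := by
        rw [ENNReal.coe_mul, ENNReal.coe_mul, ENNReal.coe_rpow_of_ne_zero two_ne_zero,
          ENNReal.coe_ofNat]
        ring

lemma exists_ofReal_mul_half_rpow_le_one (hM : 1 ≤ M) : ∃ a : ℕ,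
    ENNReal.ofReal M * 2⁻¹ ^ ((a : ℝ) / 2) ≤ 1 ∧ (a + 2 : ℝ) ≤ 3 * (1 + Real.log M) := by
  have hM0 : 0 < M := zero_lt_one.trans_le hM
  have hlog2 := Real.log_two_gt_d9
  have hlogM : 0 ≤ Real.log M := Real.log_nonneg hM
  have hlogb : Real.logb 2 M * Real.log 2 = Real.log M := div_mul_cancel₀ _ (by positivity)
  have hlogb0 : 0 ≤ Real.logb 2 M := Real.logb_nonneg one_lt_two hM
  refine ⟨⌈2 * Real.logb 2 M⌉₊, ?_, ?_⟩
  · have hle : M ≤ 2 ^ ((⌈2 * Real.logb 2 M⌉₊ : ℝ) / 2) := by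
      rw [← Real.logb_le_iff_le_rpow one_lt_two hM0]
      linarith [Nat.le_ceil (2 * Real.logb 2 M)]
    rw [ENNReal.inv_rpow, ← div_eq_mul_inv]
    refine ENNReal.div_le_of_le_mul ?_
    rw [one_mul, ← ENNReal.ofReal_ofNat, ENNReal.ofReal_rpow_of_pos two_pos]
    exact ENNReal.ofReal_le_ofReal hle
  · have hceil := Nat.ceil_lt_add_one (a := 2 * Real.logb 2 M) (by positivity)
    nlinarith

lemma exists_seqLNorm_coeffs_le {q : ℝ≥0∞} {α : ℝ} (hq : 2 ≤ q)
    (hα : α < 1 / 2 - q⁻¹.toReal) : ∃ C : ℝ, 0 < C ∧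
      ∀ {ι : Type*} {φ : ι → Lp ℂ 2 μI} {M : ℝ} {f}, IsBoundedBessel φ M → Integrable f μI →
        seqLNorm 2 q (α - 1 / 2) 2 (coeffs φ f) ≤
          ENNReal.ofReal (C * min M ((1 + Real.log M) ^ |α - 1 / 2|)) *
            lorentzZygmundNorm 2 q α f := by
  obtain ⟨C, hC⟩ := exists_seqLNorm_coeffs_le_shift hq hα
  set γ := |α - 1 / 2|
  refine ⟨(C + 1) * 3 ^ γ, by positivity, fun {ι φ M f} h hf => ?_⟩
  have hM := h.one_le
  have hlogM : 0 ≤ Real.log M := Real.log_nonneg hM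
  suffices ∃ (a : ℕ) (L : ℝ), 1 ≤ L ∧ ENNReal.ofReal M * 2⁻¹ ^ ((a : ℝ) / 2) ≤ ENNReal.ofReal L ∧
      (a + 2 : ℝ) ^ γ * L ≤ 3 ^ γ * min M ((1 + Real.log M) ^ γ) by
    obtain ⟨a, L, hL, hML, haL⟩ := this
    refine (hC h hf a (ENNReal.one_le_ofReal.2 hL) ENNReal.ofReal_ne_top hML).trans ?_
    gcongr
    rw [levelWeight_eq_ofReal, ← ENNReal.ofReal_mul (by positivity), ← ENNReal.ofReal_coe_nnreal,
      ← ENNReal.ofReal_mul (by positivity), mul_assoc]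
    refine ENNReal.ofReal_le_ofReal (mul_le_mul (by simp) ?_ (by positivity) (by positivity))
    have hcast : (1 + (a + 1 : ℕ) : ℝ) = a + 2 := by push_cast; ring
    rwa [hcast]
  rcases le_total M ((1 + Real.log M) ^ γ) with hmin | hmin
  · refine ⟨0, M, hM, by simp, ?_⟩
    rw [min_eq_left hmin]
    gcongr
    norm_num
  · obtain ⟨a, haM, ha⟩ := exists_ofReal_mul_half_rpow_le_one hM
    refine ⟨a, 1, le_rfl, by simpa using haM, ?_⟩
    rw [min_eq_right hmin, mul_one, ← Real.mul_rpow (by norm_num) (by positivity)]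
    gcongr

end Fourier

/-! ### Comparison of the target spaces -/

lemma one_add_log_le_natLogMeasure_Ico {k : ℕ} (hk : 1 ≤ k) :
    ENNReal.ofReal (1 + Real.log k) ≤ natLogMeasure (Ico k (4 * k ^ 2)) := by
  have hk0 : (0 : ℝ) < k := by exact_mod_cast hk
  have hle : k ≤ 4 * k ^ 2 := by nlinarith
  have hanti : AntitoneOn (fun x : ℝ => x⁻¹) (Icc (k : ℝ) (4 * k ^ 2 : ℕ)) :=
    fun x hx _ _ hxy => inv_anti₀ (hk0.trans_le hx.1) hxy
  have hinv : ∀ j ∈ Finset.Ico k (4 * k ^ 2), (j : ℝ≥0∞)⁻¹ = ENNReal.ofReal (j : ℝ)⁻¹ :=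
    fun j hj => by
      have hj0 : 0 < j := hk.trans (Finset.mem_Ico.1 hj).1
      rw [ENNReal.ofReal_inv_of_pos (by exact_mod_cast hj0), ENNReal.ofReal_natCast]
  rw [natLogMeasure_Ico hk, Finset.sum_congr rfl hinv,
    ← ENNReal.ofReal_sum_of_nonneg fun _ _ => by positivity]
  refine ENNReal.ofReal_le_ofReal ?_
  calc 1 + Real.log k ≤ 2 * Real.log 2 + Real.log k := by linarith [Real.log_two_gt_d9]
    _ = Real.log ((4 * k ^ 2 : ℕ) / k) := by
        have hquot : ((4 * k ^ 2 : ℕ) / k : ℝ) = 2 ^ 2 * k := by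
          push_cast
          field_simp
          norm_num
        rw [hquot, Real.log_mul (by positivity) hk0.ne', Real.log_pow, Nat.cast_ofNat]
    _ = ∫ x in (k : ℝ)..(4 * k ^ 2 : ℕ), x⁻¹ :=
        (integral_inv_of_pos hk0 (hk0.trans_le (by exact_mod_cast hle))).symm
    _ ≤ ∑ j ∈ Finset.Ico k (4 * k ^ 2), (j : ℝ)⁻¹ := hanti.integral_le_sum_Ico hle

lemma rpow_one_add_log_le_of_mem_Ico {k j : ℕ} (hk : 1 ≤ k) (hj : j ∈ Ico k (4 * k ^ 2)) (β : ℝ) :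
    ENNReal.ofReal (1 + Real.log k) ^ β ≤ 3 ^ |β| * ENNReal.ofReal (1 + Real.log j) ^ β := by
  have hk0 : (0 : ℝ) < k := by exact_mod_cast hk
  have hj0 : (0 : ℝ) < j := by exact_mod_cast hk.trans hj.1
  have hlogk : 0 ≤ Real.log k := Real.log_natCast_nonneg k
  have hlow : Real.log k ≤ Real.log j := Real.log_le_log hk0 (by exact_mod_cast hj.1)
  have hupp : Real.log j ≤ 2 * Real.log 2 + 2 * Real.log k := calc
    Real.log j ≤ Real.log ((2 * k : ℝ) ^ 2) :=
      Real.log_le_log hj0 (by rw [mul_pow]; norm_num; exact_mod_cast hj.2.le)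
    _ = 2 * Real.log 2 + 2 * Real.log k := by
      rw [Real.log_pow, Real.log_mul two_ne_zero hk0.ne', Nat.cast_ofNat, mul_add]
  refine rpow_le_rpow_abs_mul_rpow three_ne_zero ENNReal.ofNat_ne_top ?_ ?_ β <;>
    rw [← ENNReal.ofReal_ofNat 3, ← ENNReal.ofReal_mul zero_le_three] <;>
    exact ENNReal.ofReal_le_ofReal (by linarith [Real.log_two_lt_d9])

lemma rpow_one_add_log_mul_le_eLpNorm {q : ℝ≥0∞} (hq : q ≠ 0) (β : ℝ) {S : ℕ → ℝ≥0∞}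
    (hS : Monotone S) {k : ℕ} (hk : 1 ≤ k) :
    ENNReal.ofReal (1 + Real.log k) ^ (q⁻¹.toReal + β) * S k ≤
      3 ^ |β| * eLpNorm (fun j : ℕ => ENNReal.ofReal (1 + Real.log j) ^ β * S j) q
        natLogMeasure := by
  set x : ℝ≥0∞ := ENNReal.ofReal (1 + Real.log k)
  have hx : x ≠ 0 := by
    have := Real.log_natCast_nonneg k
    simp only [x, ne_eq, ENNReal.ofReal_eq_zero, not_le]
    positivity
  set I := Ico k (4 * k ^ 2)
  have hmass : x ≤ natLogMeasure I := one_add_log_le_natLogMeasure_Ico hk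
  have hne : natLogMeasure.restrict I ≠ 0 := by
    rw [Ne, Measure.restrict_eq_zero]
    exact (hx.bot_lt.trans_le hmass).ne'
  have hpoint : ∀ j ∈ I, x ^ β * S k ≤
      3 ^ |β| * (ENNReal.ofReal (1 + Real.log j) ^ β * S j) := fun j hj => by
    rw [← mul_assoc]
    exact mul_le_mul' (rpow_one_add_log_le_of_mem_Ico hk hj β) (hS hj.1)
  calc x ^ (q⁻¹.toReal + β) * S k = x ^ β * S k * x ^ (1 / q.toReal) := by
        rw [ENNReal.rpow_add _ _ hx ENNReal.ofReal_ne_top, ENNReal.toReal_inv, one_div]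
        ring
    _ ≤ eLpNorm (fun _ => x ^ β * S k) q (natLogMeasure.restrict I) := by
        rw [eLpNorm_const _ hq hne, Measure.restrict_apply_univ, enorm_eq_self]
        gcongr
    _ ≤ eLpNorm (fun j : ℕ => 3 ^ |β| * (ENNReal.ofReal (1 + Real.log j) ^ β * S j)) q
          natLogMeasure :=
        (eLpNorm_mono_enorm_ae ((ae_restrict_mem measurableSet_Ico).mono hpoint)).trans
          (eLpNorm_mono_measure _ Measure.restrict_le_self)
    _ ≤ _ := eLpNorm_const_mul_le _ (by finiteness) _

lemma seqLNorm_top_le {ι : Type*} {q : ℝ≥0∞} (hq : q ≠ 0) (p r : ℝ≥0∞) (β : ℝ) (c : ι → ℂ) :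
    seqLNorm p ∞ (q⁻¹.toReal + β) r c ≤ 3 ^ |β| * seqLNorm p q β r c := by
  rw [seqLNorm_eq_eLpNorm_natLogMeasure ENNReal.top_ne_zero, seqLNorm_eq_eLpNorm_natLogMeasure hq,
    eLpNorm_exponent_top]
  exact essSup_le_of_ae_le _ (natLogMeasure_ae_pos.mono fun k hk =>
    rpow_one_add_log_mul_le_eLpNorm hq β (truncNorm_mono p r c) hk)

theorem corollary3p4_general :
    (∀ (q : ℝ≥0∞) (α : ℝ), 2 ≤ q → α < 1 / 2 - q⁻¹.toReal →
      ∃ C : ℝ, 0 < C ∧ ∀ {ι : Type*} {φ : ι → Lp ℂ 2 μI} {M : ℝ}, IsBoundedBessel φ M →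
        ∀ f : ℝ → ℂ, MemLorentzZygmund 2 q α f →
          Integrable f μI ∧
          (∀ n, Integrable (fun x => f x * starRingEnd ℂ (φ n x)) μI) ∧
          seqLNorm 2 q (α - 1 / 2) 2 (coeffs φ f) ≤
            ENNReal.ofReal (C * min M ((1 + Real.log M) ^ |α - 1 / 2|)) *
              lorentzZygmundNorm 2 q α f) ∧
    (∀ q : ℝ≥0∞, 2 < q →
      ∃ C : ℝ, 0 < C ∧ ∀ {ι : Type*} {φ : ι → Lp ℂ 2 μI} {M : ℝ}, IsBoundedBessel φ M →
        ∀ f : ℝ → ℂ, MemLorentzZygmund 2 q 0 f →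
          seqLNorm 2 q (-1 / 2) 2 (coeffs φ f) ≤
            ENNReal.ofReal (C * (1 + Real.log M) ^ (1 / 2 : ℝ)) * lorentzZygmundNorm 2 q 0 f) ∧
    (∀ (p q r : ℝ≥0∞) (β : ℝ), q ≠ 0 →
      ∃ C : ℝ, 0 < C ∧ ∀ {ι : Type*} (c : ι → ℂ),
        seqLNorm p ∞ (q⁻¹.toReal + β) r c ≤ ENNReal.ofReal C * seqLNorm p q β r c) := by
  refine ⟨fun q α hq hα => ?_, fun q hq => ?_, fun p q r β hq => ?_⟩
  · obtain ⟨C, hC0, hC⟩ := exists_seqLNorm_coeffs_le hq hα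
    refine ⟨C, hC0, fun h f hf => ?_⟩
    have hint := integrable_of_memLorentzZygmund (one_le_two.trans hq) hf
    exact ⟨hint, fun n => integrable_mul_conj hint (h.ae_norm_le n), hC h hint⟩
  · have hα : (0 : ℝ) < 1 / 2 - q⁻¹.toReal := by
      simpa using ENNReal.toReal_strict_mono (by simp) (ENNReal.inv_lt_inv.2 hq)
    obtain ⟨C, hC0, hC⟩ := exists_seqLNorm_coeffs_le hq.le hα
    refine ⟨C, hC0, fun h f hf => ?_⟩
    have hb := hC h (integrable_of_memLorentzZygmund (one_le_two.trans hq.le) hf)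
    rw [zero_sub, abs_neg, abs_of_pos (by norm_num : (0 : ℝ) < 1 / 2), ← neg_div] at hb
    refine hb.trans ?_
    gcongr
    exact min_le_right _ _
  · refine ⟨3 ^ |β|, by positivity, fun c => ?_⟩
    rw [← ENNReal.ofReal_rpow_of_pos three_pos, ENNReal.ofReal_ofNat]
    exact seqLNorm_top_le hq p r β c

end LorentzFourier

end

theorem corollary3p4 :
    -- the general estimate
    (∀ (q : ℝ≥0∞) (α : ℝ), 2 ≤ q → α < 1 / 2 - q⁻¹.toReal →
      ∃ C : ℝ, 0 < C ∧
        ∀ (ι : Type) [Nonempty ι] (φ : ι → Lp ℂ 2 LorentzFourier.μI) (M : ℝ),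
          LorentzFourier.IsBoundedOrthonormal φ M →
          ∀ f : ℝ → ℂ, LorentzFourier.MemLorentzZygmund 2 q α f →
            Integrable f LorentzFourier.μI ∧
            (∀ n, Integrable (fun x => f x * starRingEnd ℂ (φ n x)) LorentzFourier.μI) ∧
            LorentzFourier.seqLNorm 2 q (α - 1 / 2) 2 (LorentzFourier.coeffs φ f) ≤
              ENNReal.ofReal (C * min M ((1 + Real.log M) ^ |α - 1 / 2|)) *
                LorentzFourier.lorentzZygmundNorm 2 q α f) ∧
    -- the special case of Lorentz spaces
    (∀ q : ℝ≥0∞, 2 < q →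
      ∃ C : ℝ, 0 < C ∧
        ∀ (ι : Type) [Nonempty ι] (φ : ι → Lp ℂ 2 LorentzFourier.μI) (M : ℝ),
          LorentzFourier.IsBoundedOrthonormal φ M →
          ∀ f : ℝ → ℂ, LorentzFourier.MemLorentzZygmund 2 q 0 f →
            LorentzFourier.seqLNorm 2 q (-1 / 2) 2 (LorentzFourier.coeffs φ f) ≤
              ENNReal.ofReal (C * (1 + Real.log M) ^ (1 / 2 : ℝ)) *
                LorentzFourier.lorentzZygmundNorm 2 q 0 f) ∧
    -- the target space is continuously embedded in that of the earlier estimates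
    (∀ (q : ℝ≥0∞) (α : ℝ), 2 < q → α < 1 / 2 - q⁻¹.toReal →
      ∃ C : ℝ, 0 < C ∧
        ∀ (ι : Type) (c : ι → ℂ),
          LorentzFourier.seqLNorm 2 ∞ (q⁻¹.toReal - 1 / 2 + α) 2 c ≤
            ENNReal.ofReal C * LorentzFourier.seqLNorm 2 q (α - 1 / 2) 2 c) := by
  obtain ⟨estimate, lorentz, embedding⟩ := LorentzFourier.corollary3p4_general
  refine ⟨fun q α hq hα => ?_, fun q hq => ?_, fun q α hq _ => ?_⟩
  · obtain ⟨C, hC0, hC⟩ := estimate q α hq hα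
    exact ⟨C, hC0, fun ι _ φ M h => hC h.isBoundedBessel⟩
  · obtain ⟨C, hC0, hC⟩ := lorentz q hq
    exact ⟨C, hC0, fun ι _ φ M h => hC h.isBoundedBessel⟩
  · obtain ⟨C, hC0, hC⟩ := embedding 2 q 2 (α - 1 / 2) (two_pos.trans hq).ne'
    refine ⟨C, hC0, fun ι c => ?_⟩
    rw [sub_add_eq_add_sub, add_sub_assoc]
    exact hC c
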